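/- A (finite) ribbon graph $G$ is a surface with boundary that is the union of finitely many closed discs, the vertex-discs $V(G)$ and the edge-ribbons $E(G)$, such that vertex-discs and edge-ribbons meet in disjoint line segments, each segment lies on the boundary of exactly one vertex-disc and exactly one edge-ribbon, and each edge-ribbon contains exactly two of them (its half-edges). It is presented by its signed rotation system: orient every vertex-disc, record the cyclic order of the half-edges around each vertex-disc, and give each half-edge a sign $\pm$, where the two half-edges of an edge have equal signs if the edge is untwisted (its ribbon is compatible with the orientations of the vertex-discs at its ends) and opposite signs if it is twisted. Let $F(G)$ be the set of boundary components of the surface (an isolated vertex-disc contributing one) and $c(G)$ the number of connected components. The Euler genus of $G$ is $\varepsilon(G)=2c(G)-\bigl(|V(G)|-|E(G)|+|F(G)|\bigr)$. Let $e$ be an edge joining two distinct vertex-discs. The contraction $G/e$ replaces $e$ and its two end-discs by their union, a single vertex-disc. In the signed rotation system: if the end-discs have rotations $(e\,A)$ and $(e'\,B)$, where $e,e'$ are the half-edges of $e$, then the new vertex-disc has rotation $(A\,B)$ if $e$ is untwisted and $(A\,B^{-1})$ if $e$ is twisted, where $B^{-1}$ is $B$ in reversed order with all signs changed. A bouquet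 is a ribbon graph with exactly one vertex-disc. Two loops of a bouquet $B$ are interlaced if their half-edges alternate in the cyclic order. The signed intersection graph $SI(B)$ has the loops of $B$ as vertices, two of them being adjacent if they are interlaced, and a vertex has sign $-$ if the loop is twisted and $+$ otherwise. Its adjacency matrix $\mathrm{adj}(SI(B))$ over $\mathrm{GF}(2)$ is the adjacency matrix of the underlying simple graph with, in addition, a diagonal entry $1$ at each vertex of sign $-$. **Theorem.** Let $G$ be a connected ribbon graph and let $T$ be any spanning tree of $G$. Let $Aux(G,T)$ be the ribbon graph obtained from $G$ by contracting all edges of $T$ one after another, in any order. Then $Aux(G,T)$ is a bouquet with edge set $E(G)\setminus E(T)$, and $$\varepsilon(G)=\operatorname{rank}_{\mathrm{GF}(2)}\bigl(\mathrm{adj}(SI(Aux(G,T)))\bigr).$$ -/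

import Mathlib

/-- A (finite) ribbon graph with vertex-discs labelled in `V` and edge-ribbons labelled in `E`,
presented by its signed rotation system. The half-edges (ribbon ends) of an edge `e` are `(e, false)`
and `(e, true)`. Every vertex-disc carries an orientation; `next` sends a half-edge to the one that
follows it in the cyclic order around its vertex-disc, and every half-edge carries a sign.
Vertices without half-edges are allowed. The values of `inc`, `sign` at labels that are not edges
are irrelevant. -/
structure RibbonGraph (V E : Type*) where
  /-- the vertex-discs -/
  verts : Finset V
  /-- the edge-ribbons -/
  edges : Finset E
  /-- the vertex-disc to which a half-edge is attached -/
  inc : E × Bool → V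
  /-- the rotation -/
  next : Equiv.Perm (E × Bool)
  /-- the signs of the half-edges -/
  sign : E × Bool → ℤˣ
  inc_mem : ∀ h : E × Bool, h.1 ∈ edges → inc h ∈ verts
  next_of_notMem : ∀ h : E × Bool, h.1 ∉ edges → next h = h
  inc_next : ∀ h : E × Bool, inc (next h) = inc h
  sameCycle_of_inc_eq : ∀ h k : E × Bool, h.1 ∈ edges → k.1 ∈ edges → inc h = inc k →
    next.SameCycle h k

/-- A graph whose vertices carry signs; `neg` is the set of vertices with sign `-`. -/
structure SignedGraph (W : Type*) where
  graph : SimpleGraph W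
  neg : Set W

open Classical in
/-- The adjacency matrix over `GF(2)`, with a `1` on the diagonal at each vertex of sign `-`. -/
noncomputable def SignedGraph.adj {W : Type*} (S : SignedGraph W) : Matrix W W (ZMod 2) :=
  S.graph.adjMatrix (ZMod 2) + Matrix.diagonal (fun w => if w ∈ S.neg then 1 else 0)

namespace RibbonGraph

variable {V E : Type*}

/-! ### Underlying graph, connectedness, spanning trees -/

/-- The unordered pair of end-vertices of an edge. -/
def ends (G : RibbonGraph V E) (e : E) : Sym2 V := s(G.inc (e, false), G.inc (e, true))

/-- The simple graph underlying the spanning subgraph with edge set `S`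
(loops dropped, parallel edges identified). -/
def simpleGraph (G : RibbonGraph V E) (S : Finset E) : SimpleGraph {v // v ∈ G.verts} :=
  SimpleGraph.fromRel fun u v => ∃ e ∈ S, G.ends e = s(u.1, v.1)

/-- `G` is connected (in particular it has a vertex). -/
def Connected (G : RibbonGraph V E) : Prop := (G.simpleGraph G.edges).Connected

/-- The number `c(G)` of connected components. -/
noncomputable def numComponents (G : RibbonGraph V E) : ℕ :=
  Nat.card (G.simpleGraph G.edges).ConnectedComponent

/-- `T` is the edge set of a spanning tree of `G`: it contains no loops and no two parallel edges,
and the resulting simple graph on all the vertices of `G` is a tree. -/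
structure IsSpanningTree (G : RibbonGraph V E) (T : Finset E) : Prop where
  subset : T ⊆ G.edges
  not_loop : ∀ e ∈ T, ¬ (G.ends e).IsDiag
  not_parallel : Set.InjOn G.ends T
  isTree : (G.simpleGraph T).IsTree

/-- A bouquet is a ribbon graph with exactly one vertex. -/
def IsBouquet (G : RibbonGraph V E) : Prop := G.verts.card = 1

/-! ### Faces and Euler genus -/

/-- An edge is twisted if its two half-edges carry opposite signs. For a loop this says that its
ribbon together with the vertex-disc is a Möbius band. -/
def Twisted (G : RibbonGraph V E) (e : E) : Prop := G.sign (e, false) ≠ G.sign (e, true)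

/-- The corners of `G`: the end points of the segments in which ribbons meet discs. Going round a
disc along its orientation, one passes first `(h, false)` and then `(h, true)` at the half-edge
`h`. -/
def Corner (G : RibbonGraph V E) : Type _ := {c : (E × Bool) × Bool // c.1.1 ∈ G.edges}

/-- Two corners are joined by a piece of the boundary of the surface `G`. This is either the arc of
a disc from the end of a half-edge to the beginning of the next half-edge, or one of the two free
sides of a ribbon; such a side joins a beginning to an end if the ribbon is untwisted, and
a beginning to a beginning or an end to an end if it is twisted. -/
inductive BoundaryStep (G : RibbonGraph V E) : G.Corner → G.Corner → Prop
  | arc (c d : G.Corner) (hc : c.1.2 = true) (hd : d.1 = (G.next c.1.1, false)) :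
      BoundaryStep G c d
  | untwisted (c d : G.Corner) (e : E) (i : Bool) (he : ¬ G.Twisted e)
      (hc : c.1 = ((e, false), i)) (hd : d.1 = ((e, true), !i)) : BoundaryStep G c d
  | twisted (c d : G.Corner) (e : E) (i : Bool) (he : G.Twisted e)
      (hc : c.1 = ((e, false), i)) (hd : d.1 = ((e, true), i)) : BoundaryStep G c d

/-- The faces of `G`, that is, the boundary components of the surface: the cycles of boundary pieces,
and the boundary circles of the vertex-discs without half-edges. -/
def Face (G : RibbonGraph V E) : Type _ :=
  Quot G.BoundaryStep ⊕ {v // v ∈ G.verts ∧ ∀ h : E × Bool, h.1 ∈ G.edges → G.inc h ≠ v}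

/-- The Euler characteristic `|V| - |E| + |F|`. -/
noncomputable def eulerChar (G : RibbonGraph V E) : ℤ :=
  G.verts.card - G.edges.card + Nat.card G.Face

/-- The Euler genus `2c - χ`. -/
noncomputable def eulerGenus (G : RibbonGraph V E) : ℤ := 2 * G.numComponents - G.eulerChar

/-! ### Signed intersection graph -/

/-- Following the rotation from `x`, one meets `y` strictly before meeting `z`. -/
def Meets (G : RibbonGraph V E) (x y z : E × Bool) : Prop :=
  ∃ k : ℕ, 0 < k ∧ (G.next ^ k) x = y ∧ ∀ j : ℕ, 0 < j → j ≤ k → (G.next ^ j) x ≠ z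

/-- `x, y, z, w` appear in this cyclic order in the rotation. -/
def InCyclicOrder (G : RibbonGraph V E) (x y z w : E × Bool) : Prop :=
  G.Meets x y z ∧ G.Meets y z w ∧ G.Meets z w x ∧ G.Meets w x y

/-- The half-edges of `e` and `f` alternate in the rotation. -/
def Interlaced (G : RibbonGraph V E) (e f : E) : Prop :=
  ∃ i j : Bool, G.InCyclicOrder (e, i) (f, j) (e, !i) (f, !j)

theorem Interlaced.symm {G : RibbonGraph V E} {e f : E} (h : G.Interlaced e f) :
    G.Interlaced f e := by
  obtain ⟨i, j, h1, h2, h3, h4⟩ := h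
  exact ⟨j, !i, by rw [Bool.not_not]; exact ⟨h2, h3, h4, h1⟩⟩

/-- The intersection graph of a bouquet. -/
def intersectionGraph (B : RibbonGraph V E) : SimpleGraph {e // e ∈ B.edges} where
  Adj e f := e ≠ f ∧ B.Interlaced e.1 f.1
  symm := ⟨fun _ _ h => ⟨h.1.symm, h.2.symm⟩⟩
  loopless := ⟨fun _ h => h.1 rfl⟩

/-- The signed intersection graph of a bouquet: twisted loops have sign `-`. -/
def signedIntersectionGraph (B : RibbonGraph V E) : SignedGraph {e // e ∈ B.edges} where
  graph := B.intersectionGraph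
  neg := {e | B.Twisted e.1}

/-! ### Contraction of edges -/

theorem inc_symm_next (G : RibbonGraph V E) (h : E × Bool) : G.inc (G.next.symm h) = G.inc h := by
  conv_rhs => rw [← G.next.apply_symm_apply h]
  rw [G.inc_next]

theorem inc_eq_of_sameCycle (G : RibbonGraph V E) {h k : E × Bool} (hk : G.next.SameCycle h k) :
    G.inc h = G.inc k := by
  have key : ∀ (n : ℕ) (x : E × Bool), G.inc ((G.next ^ n) x) = G.inc x := by
    intro n
    induction n with
    | zero => intro x; rfl
    | succ n ih => intro x; rw [pow_succ', Equiv.Perm.mul_apply, G.inc_next, ih]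
  obtain ⟨i, rfl⟩ := hk
  obtain ⟨n, rfl | rfl⟩ := i.eq_nat_or_neg
  · simp [key]
  · rw [← key n ((G.next ^ (-(n : ℤ))) h)]
    simp

theorem sameCycle_of_step {α : Type*} {π σ : Equiv.Perm α} (hs : ∀ x, σ.SameCycle x (π x))
    {x y : α} (h : π.SameCycle x y) : σ.SameCycle x y := by
  have key : ∀ (n : ℕ) (x : α), σ.SameCycle x ((π ^ n) x) := by
    intro n
    induction n with
    | zero => intro x; exact Equiv.Perm.SameCycle.rfl
    | succ n ih =>
      intro x
      rw [pow_succ', Equiv.Perm.mul_apply]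
      exact (ih x).trans (hs _)
  obtain ⟨i, rfl⟩ := h
  obtain ⟨n, rfl | rfl⟩ := i.eq_nat_or_neg
  · simpa using key n x
  · have := key n ((π ^ (-(n : ℤ))) x)
    simpa using this.symm

/-- Removing the point `a` from its cycle: the predecessor of `a` is sent to the successor of `a`,
and `a` becomes a fixed point. -/
def removePoint {α : Type*} [DecidableEq α] (π : Equiv.Perm α) (a : α) : Equiv.Perm α :=
  Equiv.swap a (π a) * π

theorem removePoint_self {α : Type*} [DecidableEq α] (π : Equiv.Perm α) (a : α) :
    removePoint π a a = a := by
  simp [removePoint]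

theorem removePoint_of_eq {α : Type*} [DecidableEq α] {π : Equiv.Perm α} {a x : α}
    (hx : π x = a) : removePoint π a x = π a := by
  simp [removePoint, hx]

theorem removePoint_of_ne {α : Type*} [DecidableEq α] {π : Equiv.Perm α} {a x : α}
    (hxa : x ≠ a) (hx : π x ≠ a) : removePoint π a x = π x := by
  rw [removePoint, Equiv.Perm.mul_apply, Equiv.swap_apply_of_ne_of_ne hx]
  exact fun h => hxa (π.injective h)

theorem removePoint_invariant {α β : Type*} [DecidableEq α] {π : Equiv.Perm α} (f : α → β)
    (hf : ∀ x, f (π x) = f x) (a x : α) : f (removePoint π a x) = f x := by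
  by_cases hxa : x = a
  · rw [hxa, removePoint_self]
  by_cases hx : π x = a
  · rw [removePoint_of_eq hx, hf, ← hx, hf]
  · rw [removePoint_of_ne hxa hx, hf]

theorem sameCycle_removePoint {α : Type*} [DecidableEq α] {π : Equiv.Perm α} {a x y : α}
    (hx : x ≠ a) (hy : y ≠ a) (h : π.SameCycle x y) : (removePoint π a).SameCycle x y := by
  have key : ∀ (n : ℕ) (x : α), x ≠ a →
      ((π ^ n) x ≠ a → (removePoint π a).SameCycle x ((π ^ n) x)) ∧
      ((π ^ n) x = a → (removePoint π a).SameCycle x (π a)) := by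
    intro n
    induction n with
    | zero => intro x hx; exact ⟨fun _ => Equiv.Perm.SameCycle.rfl, fun h => absurd h hx⟩
    | succ n ih =>
      intro x hx
      obtain ⟨h1, h2⟩ := ih x hx
      rw [pow_succ', Equiv.Perm.mul_apply]
      by_cases hn : (π ^ n) x = a
      · rw [hn]
        exact ⟨fun _ => h2 hn, fun h => by have := h2 hn; rwa [h] at this ⊢⟩
      · refine ⟨fun h => ?_, fun h => ?_⟩
        · rw [← removePoint_of_ne hn h]
          exact (h1 hn).apply_right
        · rw [← removePoint_of_eq h]
          exact (h1 hn).apply_right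
  obtain ⟨i, hi⟩ := h
  obtain ⟨n, rfl | rfl⟩ := i.eq_nat_or_neg
  · have hn : (π ^ n) x = y := by simpa using hi
    have := (key n x hx).1
    rw [hn] at this
    exact this hy
  · have hn : (π ^ n) y = x := by rw [← hi]; simp
    have := (key n y hy).1
    rw [hn] at this
    exact (this hx).symm

theorem next_mem (G : RibbonGraph V E) {h : E × Bool} (hh : h.1 ∈ G.edges) :
    (G.next h).1 ∈ G.edges := by
  by_contra hn
  have := G.next.injective (G.next_of_notMem _ hn)
  rw [this] at hn
  exact hn hh

theorem exists_pow_next_eq (G : RibbonGraph V E) (b : E × Bool) :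
    ∃ n : ℕ, (G.next ^ (n + 1)) b = b := by
  by_cases hb : b.1 ∈ G.edges
  · have hmem : ∀ n : ℕ, ((G.next ^ n) b) ∈ ((G.edges ×ˢ Finset.univ : Finset (E × Bool))) := by
      intro n
      induction n with
      | zero => simpa using hb
      | succ n ih =>
        rw [pow_succ', Equiv.Perm.mul_apply]
        simp only [Finset.mem_product, Finset.mem_univ, and_true] at ih ⊢
        exact G.next_mem ih
    obtain ⟨m, n, hmn, h⟩ := Set.Finite.exists_lt_map_eq_of_forall_mem
      (t := ((G.edges ×ˢ Finset.univ : Finset (E × Bool)) : Set (E × Bool)))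
      (f := fun n : ℕ => (G.next ^ n) b) (fun n => hmem n) (Finset.finite_toSet _)
    obtain ⟨k, rfl⟩ := Nat.exists_eq_add_of_lt hmn
    refine ⟨k, ?_⟩
    simp only [add_assoc, pow_add, Equiv.Perm.mul_apply] at h
    have := (G.next ^ m).injective h
    rw [pow_add, Equiv.Perm.mul_apply]
    exact this.symm
  · exact ⟨0, by simpa using G.next_of_notMem b hb⟩

theorem sameCycle_mul_swap [DecidableEq E] (G : RibbonGraph V E) {a b h k : E × Bool}
    (hab : G.inc a ≠ G.inc b) :
    (G.next.SameCycle h k → (G.next * Equiv.swap a b).SameCycle h k) ∧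
      (G.next * Equiv.swap a b).SameCycle a b := by
  set σ := G.next * Equiv.swap a b with hσ
  have ha : σ a = G.next b := by simp [hσ]
  have hb : σ b = G.next a := by simp [hσ]
  have hne : ∀ x, x ≠ a → x ≠ b → σ x = G.next x := fun x h1 h2 => by
    rw [hσ, Equiv.Perm.mul_apply, Equiv.swap_apply_of_ne_of_ne h1 h2]
  have hcyc : σ.SameCycle a b := by
    by_contra hcon
    have key : ∀ n : ℕ, σ.SameCycle a ((G.next ^ (n + 1)) b) := by
      intro n
      induction n with
      | zero =>
        rw [zero_add, pow_one, ← ha]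
        exact Equiv.Perm.SameCycle.rfl.apply_right
      | succ n ih =>
        rw [pow_succ', Equiv.Perm.mul_apply, ← hne]
        · exact ih.apply_right
        · intro h
          apply hab
          rw [← h]
          exact (G.inc_eq_of_sameCycle (Equiv.Perm.SameCycle.rfl.pow_right)).symm
        · intro h
          rw [h] at ih
          exact hcon ih
    obtain ⟨n, hn⟩ := G.exists_pow_next_eq b
    exact hcon (by simpa [hn] using key n)
  refine ⟨fun h => sameCycle_of_step (fun x => ?_) h, hcyc⟩
  by_cases hxa : x = a
  · rw [hxa, ← hb]; exact hcyc.apply_right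
  by_cases hxb : x = b
  · rw [hxb, ← ha]; exact hcyc.symm.apply_right
  rw [← hne x hxa hxb]
  exact Equiv.Perm.SameCycle.rfl.apply_right

variable [DecidableEq V]

/-- Reversing the orientation of the vertex-disc `v`: the rotation at `v` is reversed and
all signs at `v` are multiplied by `-1`. The ribbon graph stays the same up to equivalence. -/
def flip (G : RibbonGraph V E) (v : V) : RibbonGraph V E where
  verts := G.verts
  edges := G.edges
  inc := G.inc
  next :=
    { toFun := fun h => if G.inc h = v then G.next.symm h else G.next h
      invFun := fun h => if G.inc h = v then G.next h else G.next.symm h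
      left_inv := fun h => by
        by_cases hv : G.inc h = v <;> simp [hv, inc_symm_next, inc_next]
      right_inv := fun h => by
        by_cases hv : G.inc h = v <;> simp [hv, inc_symm_next, inc_next] }
  sign := fun h => if G.inc h = v then -G.sign h else G.sign h
  inc_mem := G.inc_mem
  next_of_notMem := fun h hh => by
    have h1 := G.next_of_notMem h hh
    have h2 : G.next.symm h = h := by rw [Equiv.symm_apply_eq, h1]
    simp [h1, h2]
  inc_next := fun h => by
    by_cases hv : G.inc h = v <;> simp [hv, inc_symm_next, inc_next]
  sameCycle_of_inc_eq := fun h k hh hk hhk => by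
    refine sameCycle_of_step (fun x => ?_) (G.sameCycle_of_inc_eq h k hh hk hhk)
    by_cases hv : G.inc x = v
    · refine Equiv.Perm.SameCycle.symm ⟨1, ?_⟩
      simp [hv, inc_next]
    · exact ⟨1, by simp [hv]⟩

variable [DecidableEq E]

/-- The rotation `(A B)` obtained from the rotations `(e A)` and `(e' B)`, where `e`, `e'` are the two
half-edges of an edge; the half-edges of the edge become fixed points. -/
def mergeNext (G : RibbonGraph V E) (e : E) : Equiv.Perm (E × Bool) :=
  removePoint (removePoint (G.next * Equiv.swap (e, false) (e, true)) (e, false)) (e, true)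

/-- Contraction of an untwisted edge `e` that joins two distinct vertex-discs with rotations `(e A)`
and `(e B)`: they are replaced by one vertex-disc with rotation `(A B)`. The new disc gets the label
of the vertex-disc at the half-edge `(e, false)`. -/
def merge (G : RibbonGraph V E) (e : E) (he : e ∈ G.edges)
    (hne : G.inc (e, false) ≠ G.inc (e, true)) : RibbonGraph V E where
  verts := G.verts.erase (G.inc (e, true))
  edges := G.edges.erase e
  inc := fun h => if G.inc h = G.inc (e, true) then G.inc (e, false) else G.inc h
  next := G.mergeNext e
  sign := G.sign
  inc_mem := fun h hh => by
    have h1 := G.inc_mem h (Finset.mem_of_mem_erase hh)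
    by_cases hv : G.inc h = G.inc (e, true)
    · rw [if_pos hv]
      exact Finset.mem_erase.2 ⟨hne, G.inc_mem (e, false) he⟩
    · rw [if_neg hv]
      exact Finset.mem_erase.2 ⟨hv, h1⟩
  next_of_notMem := fun h hh => by
    have h0 : removePoint (G.next * Equiv.swap (e, false) (e, true)) (e, false) (e, false)
        = (e, false) := removePoint_self _ _
    have hft : ((e, false) : E × Bool) ≠ (e, true) := by simp
    by_cases h1 : h = (e, true)
    · rw [h1, mergeNext, removePoint_self]
    by_cases h2 : h = (e, false)
    · rw [h2, mergeNext, removePoint_of_ne hft (by rw [h0]; exact hft), h0]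
    have h3 : h.1 ≠ e := by
      rintro rfl
      rcases h with ⟨x, _ | _⟩ <;> simp at h1 h2
    have h4 : h.1 ∉ G.edges := fun hm => hh (Finset.mem_erase.2 ⟨h3, hm⟩)
    have h5 : (G.next * Equiv.swap (e, false) (e, true)) h = h := by
      rw [Equiv.Perm.mul_apply, Equiv.swap_apply_of_ne_of_ne h2 h1, G.next_of_notMem h h4]
    have h6 : removePoint (G.next * Equiv.swap (e, false) (e, true)) (e, false) h = h := by
      rw [removePoint_of_ne h2 (by rw [h5]; exact h2), h5]
    rw [mergeNext, removePoint_of_ne h1 (by rw [h6]; exact h1), h6]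
  inc_next := fun h => by
    refine removePoint_invariant
      (fun h => if G.inc h = G.inc (e, true) then G.inc (e, false) else G.inc h)
      (fun x => removePoint_invariant
        (fun h => if G.inc h = G.inc (e, true) then G.inc (e, false) else G.inc h)
        (fun x => ?_) _ _) _ _
    by_cases h1 : x = (e, true)
    · simp [h1, G.inc_next]
    by_cases h2 : x = (e, false)
    · simp [h2, G.inc_next]
    rw [Equiv.Perm.mul_apply, Equiv.swap_apply_of_ne_of_ne h2 h1, G.inc_next]
  sameCycle_of_inc_eq := fun h k hh hk hhk => by
    have hh' := Finset.mem_erase.1 hh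
    have hk' := Finset.mem_erase.1 hk
    have hne' : ∀ x : E × Bool, x.1 ≠ e → ∀ i, x ≠ (e, i) := fun x hx i h => hx (by rw [h])
    refine sameCycle_removePoint (hne' h hh'.1 _) (hne' k hk'.1 _)
      (sameCycle_removePoint (hne' h hh'.1 _) (hne' k hk'.1 _) ?_)
    obtain ⟨-, hc⟩ := G.sameCycle_mul_swap (h := h) (k := k) hne
    have step : ∀ x y : E × Bool, x.1 ∈ G.edges → y.1 ∈ G.edges → G.inc x = G.inc y →
        (G.next * Equiv.swap (e, false) (e, true)).SameCycle x y := fun x y hx hy hxy =>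
      (G.sameCycle_mul_swap hne).1 (G.sameCycle_of_inc_eq x y hx hy hxy)
    by_cases h1 : G.inc h = G.inc (e, true) <;> by_cases h2 : G.inc k = G.inc (e, true)
    · exact step h k hh'.2 hk'.2 (h1.trans h2.symm)
    · rw [if_pos h1, if_neg h2] at hhk
      exact ((step h (e, true) hh'.2 he h1).trans hc.symm).trans (step (e, false) k he hk'.2 hhk)
    · rw [if_neg h1, if_pos h2] at hhk
      exact ((step h (e, false) hh'.2 he hhk).trans hc).trans (step (e, true) k he hk'.2 h2.symm)
    · rw [if_neg h1, if_neg h2] at hhk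
      exact step h k hh'.2 hk'.2 hhk

open Classical in
/-- The contraction `G / e` of an edge that joins two distinct vertex-discs `(e A)` and `(± e B)`.
If `e` is untwisted the new vertex-disc has the rotation `(A B)`. If `e` is twisted, it has the
rotation `(A B⁻¹)`, where `B⁻¹` is `B` reversed and with all signs changed.
(Only such edges are contracted: by convention `G / e = G` for all others.) -/
noncomputable def contract (G : RibbonGraph V E) (e : E) : RibbonGraph V E :=
  if h : e ∈ G.edges ∧ G.inc (e, false) ≠ G.inc (e, true) then
    if G.Twisted e then (G.flip (G.inc (e, true))).merge e h.1 h.2 else G.merge e h.1 h.2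
  else G

/-- The ribbon graph obtained from `G` by contracting the edges in the list `l` one after another.
If `l` lists the edges of a spanning tree `T`, this is the auxiliary bouquet of `G` and `T`. -/
noncomputable def aux (G : RibbonGraph V E) (l : List E) : RibbonGraph V E := l.foldl contract G

end RibbonGraph

/-!
A boundary component of a ribbon graph is a class of corners, so the components that meet a ribbon
are counted by the dimension of the space of `ZMod 2`-colourings of the corners that are constant
along the boundary. Reversing a disc only relabels the corners, and contracting an untwisted edge
only forgets the corners of that edge; hence the Euler characteristic survives every contraction of
a tree edge, and `G` has the Euler genus of its auxiliary bouquet.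

In a bouquet, walk once around the disc, adding at each half-edge of `e` the difference `x e` of the
colours of the two sides of `e`. The colours met on the way are determined by `x` and the first
colour. They agree across the ribbon `e` if and only if the row of `e` in the adjacency matrix of
the signed intersection graph annihilates `x`, because an odd number of half-edges of `f` lies
between the half-edges of `e` exactly when `e` and `f` are interlaced. So the colourings modulo
constants are the kernel of that matrix.
-/

namespace RibbonGraph

variable {V E : Type*}

section Permutation

variable {α β : Type*} [DecidableEq α]

theorem removePoint_comp_eq {π : Equiv.Perm α} {a : α} {f g : α → β} (hfg : ∀ x, f (π x) = g x)
    (ha : f a = g a) (x : α) : f (removePoint π a x) = g x := by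
  by_cases hxa : x = a
  · rw [hxa, removePoint_self, ha]
  by_cases hx : π x = a
  · rw [removePoint_of_eq hx, hfg, ← ha, ← hx, hfg]
  · rw [removePoint_of_ne hxa hx, hfg]

theorem update_comp_eq_of_removePoint {π : Equiv.Perm α} {a : α} {f g : α → β}
    (hfg : ∀ x, f (removePoint π a x) = g x) (x : α) :
    Function.update f a (f (π a)) (π x) = Function.update g a (f (π a)) x := by
  by_cases hxa : x = a
  · by_cases ha : π a = a <;> simp [hxa, ha]
  by_cases hx : π x = a
  · rw [hx, Function.update_self, Function.update_of_ne hxa, ← hfg, removePoint_of_eq hx]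
  · rw [Function.update_of_ne hx, Function.update_of_ne hxa, ← hfg, removePoint_of_ne hxa hx]

end Permutation

section MergeNext

variable {β : Type*} [DecidableEq E]

theorem mergeNext_comp_eq {G : RibbonGraph V E} {e : E} {f g : E × Bool → β}
    (hfg : ∀ h, f (G.next h) = g h) (he : ∀ i, f (e, i) = g (e, !i)) {h : E × Bool}
    (hh : h.1 ≠ e) : f (G.mergeNext e h) = g h := by
  have hne : ∀ i, h ≠ (e, i) := fun i hi => hh (by rw [hi])
  have hg : f (G.mergeNext e h) = g (Equiv.swap (e, false) (e, true) h) :=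
    removePoint_comp_eq (g := g ∘ Equiv.swap (e, false) (e, true))
      (removePoint_comp_eq (fun x => hfg _) (by simp [he])) (by simp [he]) h
  rwa [Equiv.swap_apply_of_ne_of_ne (hne _) (hne _)] at hg

theorem exists_next_comp_eq_of_mergeNext {G : RibbonGraph V E} {e : E} {f g : E × Bool → β}
    (hfg : ∀ h, f (G.mergeNext e h) = g h) :
    ∃ f' g' : E × Bool → β, (∀ h, f' (G.next h) = g' h) ∧ (∀ i, f' (e, i) = g' (e, !i)) ∧
      ∀ h, h.1 ≠ e → f' h = f h ∧ g' h = g h := by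
  set π := G.next * Equiv.swap (e, false) (e, true) with hπ
  set b := f (removePoint π (e, false) (e, true)) with hb
  have h₁ := update_comp_eq_of_removePoint (a := (e, true)) (π := removePoint π (e, false)) hfg
  have h₂ := update_comp_eq_of_removePoint h₁
  rw [← hb] at h₂
  set f₁ := Function.update f (e, true) b
  set g₁ := Function.update g (e, true) b
  set a := f₁ (π (e, false))
  refine ⟨Function.update f₁ (e, false) a,
    Function.update g₁ (e, false) a ∘ Equiv.swap (e, false) (e, true), fun h => ?_, ?_, ?_⟩
  · simpa [hπ] using h₂ (Equiv.swap (e, false) (e, true) h)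
  · rintro (_ | _) <;> simp [f₁, g₁]
  · intro h hh
    have hne : ∀ i, h ≠ (e, i) := fun i hi => hh (by rw [hi])
    simp [f₁, g₁, Equiv.swap_apply_of_ne_of_ne, hne]

theorem fst_mergeNext_ne {G : RibbonGraph V E} {e : E} (he : e ∈ G.edges)
    (hne : G.inc (e, false) ≠ G.inc (e, true)) {h : E × Bool} (hh : h.1 ≠ e) :
    (G.mergeNext e h).1 ≠ e := fun hn => by
  classical
  have hfix : G.mergeNext e (G.mergeNext e h) = G.mergeNext e h :=
    (G.merge e he hne).next_of_notMem _ fun hmem => (Finset.mem_erase.1 hmem).1 hn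
  rw [(G.mergeNext e).injective hfix] at hn
  exact hh hn

end MergeNext

section BoundaryColouring

open Classical in
/-- The side of one half-edge of `e` to which the free sides of the ribbon join the side `i` of the
other half-edge; sides are encoded as in `Corner`. -/
noncomputable def oppositeSide (G : RibbonGraph V E) (e : E) (i : Bool) : Bool :=
  if G.Twisted e then i else !i

theorem oppositeSide_oppositeSide (G : RibbonGraph V E) (e : E) (i : Bool) :
    G.oppositeSide e (G.oppositeSide e i) = i := by
  unfold oppositeSide
  split_ifs <;> simp

/-- A colouring of the corners of `G` by `ZMod 2` that is constant along the boundary of the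
surface. It is encoded as a function on all of `(E × Bool) × Bool` that vanishes at the labels that
are not corners. -/
structure IsBoundaryColouring (G : RibbonGraph V E) (c : (E × Bool) × Bool → ZMod 2) : Prop where
  eq_zero : ∀ p, p.1.1 ∉ G.edges → c p = 0
  arc : ∀ h, c (G.next h, false) = c (h, true)
  side : ∀ e j i, c ((e, !j), G.oppositeSide e i) = c ((e, j), i)

/-- The space of boundary colourings of `G`; its dimension is the number of boundary components that
meet a ribbon. -/
def boundaryColourings (G : RibbonGraph V E) : Submodule (ZMod 2) ((E × Bool) × Bool → ZMod 2) where
  carrier := {c | G.IsBoundaryColouring c}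
  add_mem' hc hd :=
    { eq_zero := fun p hp => by simp [hc.eq_zero p hp, hd.eq_zero p hp]
      arc := fun h => by simp [hc.arc, hd.arc]
      side := fun e j i => by simp [hc.side, hd.side] }
  zero_mem' := ⟨fun _ _ => rfl, fun _ => rfl, fun _ _ _ => rfl⟩
  smul_mem' a c hc :=
    { eq_zero := fun p hp => by simp [hc.eq_zero p hp]
      arc := fun h => by simp [hc.arc]
      side := fun e j i => by simp [hc.side] }

theorem IsBoundaryColouring.eq_of_boundaryStep {G : RibbonGraph V E}
    {c : (E × Bool) × Bool → ZMod 2} (hc : G.IsBoundaryColouring c) {x y : G.Corner}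
    (hxy : G.BoundaryStep x y) : c x.1 = c y.1 := by
  cases hxy with
  | arc hx hy => rw [hy, hc.arc, ← hx]
  | untwisted e i he hx hy =>
    rw [hx, hy, ← hc.side e false i, oppositeSide, if_neg he, Bool.not_false]
  | twisted e i he hx hy =>
    rw [hx, hy, ← hc.side e false i, oppositeSide, if_pos he, Bool.not_false]

theorem mk_side_eq (G : RibbonGraph V E) {e : E} (he : e ∈ G.edges) (i : Bool) :
    Quot.mk G.BoundaryStep ⟨((e, false), i), he⟩ =
      Quot.mk G.BoundaryStep ⟨((e, true), G.oppositeSide e i), he⟩ := by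
  unfold oppositeSide
  split_ifs with ht
  · exact Quot.sound (.twisted _ _ e i ht rfl rfl)
  · exact Quot.sound (.untwisted _ _ e i ht rfl rfl)

open Classical in
theorem isBoundaryColouring_extend (G : RibbonGraph V E) (φ : Quot G.BoundaryStep → ZMod 2) :
    G.IsBoundaryColouring
      fun p => if hp : p.1.1 ∈ G.edges then φ (Quot.mk _ ⟨p, hp⟩) else 0 where
  eq_zero p hp := dif_neg hp
  arc h := by
    by_cases hh : h.1 ∈ G.edges
    · have hn := G.next_mem hh
      simp only [hh, hn, dif_pos]
      exact congrArg φ (Quot.sound (.arc ⟨(h, true), hh⟩ ⟨(G.next h, false), hn⟩ rfl rfl)).symm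
    · rw [G.next_of_notMem h hh, dif_neg hh, dif_neg hh]
  side e j i := by
    by_cases he : e ∈ G.edges
    · simp only [he, dif_pos]
      cases j
      · exact congrArg φ (G.mk_side_eq he i).symm
      · refine congrArg φ ((G.mk_side_eq he _).trans ?_)
        simp only [oppositeSide_oppositeSide]
    · rw [dif_neg he, dif_neg he]

open Classical in
/-- Boundary colourings as functions on the set of boundary components that meet a ribbon. -/
noncomputable def boundaryColouringsEquiv (G : RibbonGraph V E) :
    G.boundaryColourings ≃ₗ[ZMod 2] (Quot G.BoundaryStep → ZMod 2) where
  toFun c := Quot.lift (fun x => c.1 x.1) fun _ _ => c.2.eq_of_boundaryStep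
  map_add' c d := by ext ⟨x⟩; rfl
  map_smul' a c := by ext ⟨x⟩; rfl
  invFun φ := ⟨_, G.isBoundaryColouring_extend φ⟩
  left_inv c := by
    ext p
    by_cases hp : p.1.1 ∈ G.edges
    · exact dif_pos hp
    · exact (dif_neg hp).trans (c.2.eq_zero p hp).symm
  right_inv φ := by
    ext ⟨x⟩
    exact dif_pos x.2

instance finite_corner (G : RibbonGraph V E) : Finite G.Corner :=
  Finite.of_injective (β := {e // e ∈ G.edges} × Bool × Bool)
    (fun x => (⟨x.1.1.1, x.2⟩, x.1.1.2, x.1.2)) fun x y h => by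
      simp only [Prod.mk.injEq, Subtype.mk.injEq] at h
      exact Subtype.ext (Prod.ext (Prod.ext h.1 h.2.1) h.2.2)

instance finite_boundaryColourings (G : RibbonGraph V E) :
    Module.Finite (ZMod 2) G.boundaryColourings :=
  Module.Finite.equiv G.boundaryColouringsEquiv.symm

theorem finrank_boundaryColourings (G : RibbonGraph V E) :
    Module.finrank (ZMod 2) G.boundaryColourings = Nat.card (Quot G.BoundaryStep) := by
  have := Fintype.ofFinite (Quot G.BoundaryStep)
  rw [G.boundaryColouringsEquiv.finrank_eq, Module.finrank_fintype_fun_eq_card,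
    Nat.card_eq_fintype_card]

/-- The vertex-discs without half-edges. -/
def isolatedVerts (G : RibbonGraph V E) : Set V :=
  {v | v ∈ G.verts ∧ ∀ h : E × Bool, h.1 ∈ G.edges → G.inc h ≠ v}

theorem isolatedVerts_finite (G : RibbonGraph V E) : G.isolatedVerts.Finite :=
  G.verts.finite_toSet.subset fun _ hv => hv.1

theorem card_face (G : RibbonGraph V E) :
    Nat.card G.Face = Module.finrank (ZMod 2) G.boundaryColourings + G.isolatedVerts.ncard := by
  have : Finite {v // v ∈ G.verts ∧ ∀ h : E × Bool, h.1 ∈ G.edges → G.inc h ≠ v} :=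
    G.isolatedVerts_finite
  rw [finrank_boundaryColourings, ← Nat.card_coe_set_eq]
  exact Nat.card_sum

end BoundaryColouring

section Flip

variable [DecidableEq V]

theorem flip_flip (G : RibbonGraph V E) (v : V) : (G.flip v).flip v = G := by
  rcases G with ⟨vs, es, inc, next, sign, h1, h2, h3, h4⟩
  simp only [flip, mk.injEq, true_and]
  constructor
  · ext1 h
    by_cases hv : inc h = v <;> simp [hv]
  · funext h
    by_cases hv : inc h = v <;> simp [hv]

theorem flip_twisted_iff (G : RibbonGraph V E) (v : V) (e : E) :
    (G.flip v).Twisted e ↔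
      (G.Twisted e ↔ (G.inc (e, false) = v ↔ G.inc (e, true) = v)) := by
  unfold Twisted flip
  by_cases h1 : G.inc (e, false) = v <;> by_cases h2 : G.inc (e, true) = v <;>
    rcases Int.units_eq_one_or (G.sign (e, false)) with h3 | h3 <;>
    rcases Int.units_eq_one_or (G.sign (e, true)) with h4 | h4 <;>
    simp only [h1, h2, h3, h4] <;> decide

/-- The relabelling of the corners under reversal of the vertex-disc `v`: at `v`, the beginning and
the end of each segment are exchanged. -/
def flipCorner (G : RibbonGraph V E) (v : V) (p : (E × Bool) × Bool) : (E × Bool) × Bool :=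
  (p.1, if G.inc p.1 = v then !p.2 else p.2)

theorem flipCorner_involutive (G : RibbonGraph V E) (v : V) :
    Function.Involutive (G.flipCorner v) := by
  intro p
  unfold flipCorner
  split_ifs <;> simp

theorem oppositeSide_flip (G : RibbonGraph V E) (v : V) (e : E) (j i : Bool) :
    (if G.inc (e, !j) = v then !(G.flip v).oppositeSide e i else (G.flip v).oppositeSide e i) =
      G.oppositeSide e (if G.inc (e, j) = v then !i else i) := by
  have ht' := G.flip_twisted_iff v e
  unfold oppositeSide
  by_cases ht : G.Twisted e <;> by_cases h₁ : G.inc (e, false) = v <;>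
    by_cases h₂ : G.inc (e, true) = v <;> cases j <;>
    simp [ht, ht', h₁, h₂]

theorem IsBoundaryColouring.comp_flipCorner {G : RibbonGraph V E}
    {c : (E × Bool) × Bool → ZMod 2} (hc : G.IsBoundaryColouring c) (v : V) :
    (G.flip v).IsBoundaryColouring (c ∘ G.flipCorner v) where
  eq_zero p hp := hc.eq_zero _ hp
  arc h := by
    by_cases hv : G.inc h = v
    · simpa [flip, flipCorner, hv, inc_symm_next] using (hc.arc (G.next.symm h)).symm
    · simpa [flip, flipCorner, hv, inc_next] using hc.arc h
  side e j i := by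
    simp only [Function.comp_apply, flipCorner, oppositeSide_flip]
    exact hc.side _ _ _

theorem finrank_boundaryColourings_le_flip (G : RibbonGraph V E) (v : V) :
    Module.finrank (ZMod 2) G.boundaryColourings ≤
      Module.finrank (ZMod 2) (G.flip v).boundaryColourings :=
  LinearMap.finrank_le_finrank_of_injective
    (f := (LinearMap.funLeft (ZMod 2) (ZMod 2) (G.flipCorner v)).restrict
      fun _ hc => IsBoundaryColouring.comp_flipCorner hc v)
    fun _ _ h => Subtype.ext
      ((G.flipCorner_involutive v).surjective.injective_comp_right (congrArg Subtype.val h))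

theorem card_face_flip (G : RibbonGraph V E) (v : V) :
    Nat.card (G.flip v).Face = Nat.card G.Face := by
  have hle := (G.flip v).finrank_boundaryColourings_le_flip v
  rw [flip_flip] at hle
  rw [card_face, card_face, hle.antisymm (G.finrank_boundaryColourings_le_flip v)]
  rfl

theorem eulerChar_flip (G : RibbonGraph V E) (v : V) : (G.flip v).eulerChar = G.eulerChar := by
  rw [eulerChar, card_face_flip]
  rfl

end Flip

section IsolatedEdge

variable {G : RibbonGraph V E} {e : E}

/-- Both ends of `e` lie on vertex-discs, assumed distinct, that have no further half-edge. -/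
def IsIsolatedEdge (G : RibbonGraph V E) (e : E) : Prop :=
  ∀ i, G.next (e, i) = (e, i)

theorem fst_next_ne (hne : G.inc (e, false) ≠ G.inc (e, true)) {i : Bool}
    (hi : G.next (e, i) ≠ (e, i)) : (G.next (e, i)).1 ≠ e := by
  intro hn
  have hnot : G.next (e, i) = (e, !i) := by
    refine Prod.ext hn (Bool.eq_not.2 fun h => hi (Prod.ext hn h))
  have hinc := G.inc_next (e, i)
  rw [hnot] at hinc
  cases i
  exacts [hne hinc.symm, hne hinc]

theorem fst_next_symm_ne (hne : G.inc (e, false) ≠ G.inc (e, true)) {i : Bool}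
    (hi : G.next (e, i) ≠ (e, i)) : (G.next.symm (e, i)).1 ≠ e := by
  intro hn
  obtain ⟨j, hj⟩ : ∃ j, G.next.symm (e, i) = (e, j) := ⟨_, Prod.ext hn rfl⟩
  have hji : G.next (e, j) = (e, i) := by rw [← hj, Equiv.apply_symm_apply]
  refine fst_next_ne hne (fun h => hi ?_) (congrArg Prod.fst hji)
  rwa [h.symm.trans hji] at h

theorem IsIsolatedEdge.inc_ne (hiso : G.IsIsolatedEdge e) (he : e ∈ G.edges) {h : E × Bool}
    (hh : h.1 ∈ G.edges) (hhe : h.1 ≠ e) (i : Bool) : G.inc h ≠ G.inc (e, i) := fun hinc => by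
  obtain ⟨n, hn⟩ := G.sameCycle_of_inc_eq (e, i) h he hh hinc.symm
  rw [Function.IsFixedPt.perm_zpow (hiso i) n] at hn
  exact hhe (congrArg Prod.fst hn).symm

theorem exists_inc_eq_of_not_isIsolatedEdge (hiso : ¬ G.IsIsolatedEdge e) (he : e ∈ G.edges)
    (hne : G.inc (e, false) ≠ G.inc (e, true)) :
    ∃ h : E × Bool, h.1 ∈ G.edges ∧ h.1 ≠ e ∧ ∃ i, G.inc h = G.inc (e, i) := by
  obtain ⟨i, hi⟩ := not_forall.1 hiso
  exact ⟨G.next (e, i), G.next_mem he, fst_next_ne hne hi, i, G.inc_next _⟩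

theorem IsBoundaryColouring.apply_eq_of_isIsolatedEdge {c : (E × Bool) × Bool → ZMod 2}
    (hc : G.IsBoundaryColouring c) (ht : ¬ G.Twisted e) (hiso : G.IsIsolatedEdge e) (j k : Bool) :
    c ((e, j), k) = c ((e, false), false) := by
  have harc : ∀ i, c ((e, i), false) = c ((e, i), true) := fun i => by
    rw [← hc.arc, hiso i]
  have hside : c ((e, true), true) = c ((e, false), false) := by
    simpa [oppositeSide, ht] using hc.side e false false
  cases j <;> cases k <;> simp [harc, hside]

end IsolatedEdge

section EraseLabel

variable [DecidableEq E]

/-- The restriction of a function on the corners to those that do not lie on the edge `e`,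
extended by zero. -/
def eraseLabel (e : E) :
    ((E × Bool) × Bool → ZMod 2) →ₗ[ZMod 2] ((E × Bool) × Bool → ZMod 2) where
  toFun c p := if p.1.1 = e then 0 else c p
  map_add' c d := by
    ext p
    by_cases hp : p.1.1 = e <;> simp [hp]
  map_smul' a c := by
    ext p
    by_cases hp : p.1.1 = e <;> simp [hp]

theorem eraseLabel_of_eq {e : E} {p : (E × Bool) × Bool} (hp : p.1.1 = e)
    (c : (E × Bool) × Bool → ZMod 2) : eraseLabel e c p = 0 :=
  if_pos hp

theorem eraseLabel_of_ne {e : E} {p : (E × Bool) × Bool} (hp : p.1.1 ≠ e)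
    (c : (E × Bool) × Bool → ZMod 2) : eraseLabel e c p = c p :=
  if_neg hp

variable {G : RibbonGraph V E} {e : E}

theorem IsBoundaryColouring.eq_zero_of_eraseLabel_eq_zero {c : (E × Bool) × Bool → ZMod 2}
    (hc : G.IsBoundaryColouring c) (hne : G.inc (e, false) ≠ G.inc (e, true))
    (hiso : ¬ G.IsIsolatedEdge e) (h0 : eraseLabel e c = 0) : c = 0 := by
  have hoff : ∀ p : (E × Bool) × Bool, p.1.1 ≠ e → c p = 0 := fun p hp => by
    rw [← eraseLabel_of_ne hp c, h0, Pi.zero_apply]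
  obtain ⟨i, hi⟩ := not_forall.1 hiso
  have hend : c ((e, i), true) = 0 := by
    rw [← hc.arc, hoff (G.next (e, i), false) (fst_next_ne hne hi)]
  have hbegin : c ((e, i), false) = 0 := by
    have harc := hc.arc (G.next.symm (e, i))
    rwa [Equiv.apply_symm_apply, hoff (G.next.symm (e, i), true) (fst_next_symm_ne hne hi)] at harc
  have hi0 : ∀ k, c ((e, i), k) = 0 := fun k => by cases k <;> assumption
  ext ⟨⟨x, j⟩, k⟩
  by_cases hx : x = e
  · subst hx
    obtain rfl | rfl := Bool.eq_or_eq_not j i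
    · exact hi0 k
    · rw [← hc.side, Bool.not_not, hi0, Pi.zero_apply]
  · exact hoff _ hx

theorem isBoundaryColouring_of_isIsolatedEdge (he : e ∈ G.edges) (hiso : G.IsIsolatedEdge e) :
    G.IsBoundaryColouring fun p => if p.1.1 = e then 1 else 0 where
  eq_zero p hp := if_neg fun h => hp (by rwa [h])
  arc h := by
    have hiff : (G.next h).1 = e ↔ h.1 = e := by
      refine ⟨fun hn => ?_, fun hh => ?_⟩
      · obtain ⟨i, hi⟩ : ∃ i, G.next h = (e, i) := ⟨_, Prod.ext hn rfl⟩
        rw [G.next.injective (hi.trans (hiso i).symm)]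
      · obtain ⟨x, i⟩ := h
        obtain rfl : x = e := hh
        rw [hiso i]
    simp only [hiff]
  side _ _ _ := rfl

end EraseLabel

section Merge

variable [DecidableEq V] [DecidableEq E] {G : RibbonGraph V E} {e : E}

theorem IsBoundaryColouring.merge {c : (E × Bool) × Bool → ZMod 2}
    (hc : G.IsBoundaryColouring c) (he : e ∈ G.edges)
    (hne : G.inc (e, false) ≠ G.inc (e, true)) (ht : ¬ G.Twisted e) :
    (G.merge e he hne).IsBoundaryColouring (eraseLabel e c) where
  eq_zero p hp := by
    by_cases hpe : p.1.1 = e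
    · exact eraseLabel_of_eq hpe c
    · rw [eraseLabel_of_ne hpe, hc.eq_zero p fun hmem => hp (Finset.mem_erase.2 ⟨hpe, hmem⟩)]
  arc h := by
    by_cases hh : h.1 = e
    · have hfix : (G.merge e he hne).next h = h :=
        (G.merge e he hne).next_of_notMem h fun hmem => (Finset.mem_erase.1 hmem).1 hh
      rw [hfix, eraseLabel_of_eq hh, eraseLabel_of_eq hh]
    · rw [eraseLabel_of_ne (fst_mergeNext_ne he hne hh), eraseLabel_of_ne hh]
      exact mergeNext_comp_eq (f := fun h => c (h, false)) (g := fun h => c (h, true)) hc.arc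
        (fun i => by simpa [oppositeSide, ht] using (hc.side e i false).symm) hh
  side x j i := by
    by_cases hx : x = e
    · rw [eraseLabel_of_eq hx, eraseLabel_of_eq hx]
    · rw [eraseLabel_of_ne hx, eraseLabel_of_ne hx]
      exact hc.side x j i

theorem IsBoundaryColouring.exists_eraseLabel_eq {he : e ∈ G.edges}
    {hne : G.inc (e, false) ≠ G.inc (e, true)} {d : (E × Bool) × Bool → ZMod 2}
    (hd : (G.merge e he hne).IsBoundaryColouring d) (ht : ¬ G.Twisted e) :
    ∃ c, G.IsBoundaryColouring c ∧ eraseLabel e c = d := by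
  obtain ⟨f, g, hnext, hedge, hoff⟩ := exists_next_comp_eq_of_mergeNext
    (f := fun h => d (h, false)) (g := fun h => d (h, true)) hd.arc
  set c : (E × Bool) × Bool → ZMod 2 := fun p => if p.2 then g p.1 else f p.1 with hc
  have hcd : ∀ p : (E × Bool) × Bool, p.1.1 ≠ e → c p = d p := by
    rintro ⟨h, _ | _⟩ hp
    exacts [(hoff h hp).1, (hoff h hp).2]
  refine ⟨c, ⟨fun p hp => ?_, hnext, fun x j i => ?_⟩, ?_⟩
  · rw [hcd p fun h => hp (h ▸ he), hd.eq_zero p fun h => hp (Finset.mem_of_mem_erase h)]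
  · by_cases hx : x = e
    · subst hx
      cases i
      · simpa [oppositeSide, ht, hc] using (hedge j).symm
      · simpa [oppositeSide, ht, hc] using hedge !j
    · rw [hcd _ hx, hcd _ hx]
      exact hd.side x j i
  · ext p
    by_cases hp : p.1.1 = e
    · rw [eraseLabel_of_eq hp, hd.eq_zero p fun h => (Finset.mem_erase.1 h).1 hp]
    · rw [eraseLabel_of_ne hp, hcd p hp]

theorem map_eraseLabel_boundaryColourings (he : e ∈ G.edges)
    (hne : G.inc (e, false) ≠ G.inc (e, true)) (ht : ¬ G.Twisted e) :
    G.boundaryColourings.map (eraseLabel e) = (G.merge e he hne).boundaryColourings :=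
  Submodule.ext fun _ =>
    ⟨fun ⟨_, hc, hcd⟩ => hcd ▸ IsBoundaryColouring.merge hc he hne ht,
      fun hd => IsBoundaryColouring.exists_eraseLabel_eq hd ht⟩

theorem finrank_boundaryColourings_merge_of_not_isIsolatedEdge (he : e ∈ G.edges)
    (hne : G.inc (e, false) ≠ G.inc (e, true)) (ht : ¬ G.Twisted e)
    (hiso : ¬ G.IsIsolatedEdge e) :
    Module.finrank (ZMod 2) (G.merge e he hne).boundaryColourings =
      Module.finrank (ZMod 2) G.boundaryColourings := by
  have hker : ((eraseLabel e).domRestrict G.boundaryColourings).ker = ⊥ :=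
    LinearMap.ker_eq_bot'.2 fun c h0 => Subtype.ext <|
      IsBoundaryColouring.eq_zero_of_eraseLabel_eq_zero c.2 hne hiso h0
  rw [← map_eraseLabel_boundaryColourings he hne ht, ← LinearMap.range_domRestrict,
    LinearMap.finrank_range_of_inj (LinearMap.ker_eq_bot.1 hker)]

theorem finrank_boundaryColourings_merge_of_isIsolatedEdge (he : e ∈ G.edges)
    (hne : G.inc (e, false) ≠ G.inc (e, true)) (ht : ¬ G.Twisted e) (hiso : G.IsIsolatedEdge e) :
    Module.finrank (ZMod 2) (G.merge e he hne).boundaryColourings + 1 =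
      Module.finrank (ZMod 2) G.boundaryColourings := by
  set f := (eraseLabel e).domRestrict G.boundaryColourings
  have hker : Module.finrank (ZMod 2) f.ker = 1 := by
    let u : G.boundaryColourings := ⟨_, isBoundaryColouring_of_isIsolatedEdge he hiso⟩
    have hu : f u = 0 := by
      ext p
      by_cases hp : p.1.1 = e
      · exact eraseLabel_of_eq hp _
      · exact (eraseLabel_of_ne hp _).trans (if_neg hp)
    refine finrank_eq_one (⟨u, hu⟩ : f.ker) (fun h => ?_) fun ⟨c, hc0⟩ =>
      ⟨c.1 ((e, false), false), Subtype.ext (Subtype.ext (funext fun ⟨⟨x, j⟩, k⟩ => ?_))⟩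
    · have := congrFun (congrArg (fun c : f.ker => c.1.1) h) ((e, false), false)
      simp [u] at this
    · by_cases hx : x = e
      · subst hx
        simp [u, c.2.apply_eq_of_isIsolatedEdge ht hiso j k]
      · have hcx : c.1 ((x, j), k) = 0 :=
          (eraseLabel_of_ne (p := ((x, j), k)) hx c.1).symm.trans (congrFun hc0 _)
        simp [u, hx, hcx]
  rw [← f.finrank_range_add_finrank_ker, hker, LinearMap.range_domRestrict,
    map_eraseLabel_boundaryColourings he hne ht]

theorem inc_merge (he : e ∈ G.edges) (hne : G.inc (e, false) ≠ G.inc (e, true)) (h : E × Bool) :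
    (G.merge e he hne).inc h = if G.inc h = G.inc (e, true) then G.inc (e, false) else G.inc h :=
  rfl

theorem isolatedVerts_merge (he : e ∈ G.edges) (hne : G.inc (e, false) ≠ G.inc (e, true)) :
    (G.merge e he hne).isolatedVerts =
      {v | v = G.inc (e, false) ∧ G.IsIsolatedEdge e} ∪ G.isolatedVerts := by
  ext v
  constructor
  · rintro ⟨hv, hinc⟩
    obtain ⟨hvt, hvG⟩ := Finset.mem_erase.1 hv
    have hoff : ∀ h : E × Bool, h.1 ∈ G.edges → h.1 ≠ e →
        (if G.inc h = G.inc (e, true) then G.inc (e, false) else G.inc h) ≠ v :=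
      fun h hh hhe => hinc h (Finset.mem_erase.2 ⟨hhe, hh⟩)
    by_cases hvs : v = G.inc (e, false)
    · refine .inl ⟨hvs, ?_⟩
      by_contra hiso
      obtain ⟨h, hh, hhe, i, hi⟩ := exists_inc_eq_of_not_isIsolatedEdge hiso he hne
      refine hoff h hh hhe ?_
      cases i <;> simp [hi, hvs]
    · refine .inr ⟨hvG, fun h hh hhv => ?_⟩
      obtain ⟨x, i⟩ := h
      by_cases hx : x = e
      · subst hx
        cases i
        exacts [hvs hhv.symm, hvt hhv.symm]
      · exact hoff _ hh hx (by rw [hhv, if_neg hvt])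
  · rintro (⟨rfl, hiso⟩ | ⟨hv, hinc⟩)
    · refine ⟨Finset.mem_erase.2 ⟨hne, G.inc_mem _ he⟩, fun h hh => ?_⟩
      obtain ⟨hhe, hhG⟩ := Finset.mem_erase.1 hh
      rw [inc_merge, if_neg (hiso.inc_ne he hhG hhe true)]
      exact hiso.inc_ne he hhG hhe false
    · refine ⟨Finset.mem_erase.2 ⟨(hinc _ he).symm, hv⟩, fun h hh => ?_⟩
      rw [inc_merge]
      split_ifs
      exacts [hinc _ he, hinc h (Finset.mem_of_mem_erase hh)]

theorem card_face_merge (he : e ∈ G.edges) (hne : G.inc (e, false) ≠ G.inc (e, true))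
    (ht : ¬ G.Twisted e) : Nat.card (G.merge e he hne).Face = Nat.card G.Face := by
  rw [card_face, card_face, isolatedVerts_merge]
  by_cases hiso : G.IsIsolatedEdge e
  · have hnot : G.inc (e, false) ∉ G.isolatedVerts := fun h => h.2 _ he rfl
    simp only [hiso, and_true, Set.ofPred_eq_eq_singleton, Set.singleton_union]
    rw [Set.ncard_insert_of_notMem hnot G.isolatedVerts_finite,
      ← finrank_boundaryColourings_merge_of_isIsolatedEdge he hne ht hiso]
    ring
  · simp [hiso, finrank_boundaryColourings_merge_of_not_isIsolatedEdge he hne ht hiso]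

theorem card_verts_merge (he : e ∈ G.edges) (hne : G.inc (e, false) ≠ G.inc (e, true)) :
    (G.merge e he hne).verts.card + 1 = G.verts.card :=
  Finset.card_erase_add_one (G.inc_mem _ he)

theorem eulerChar_merge (he : e ∈ G.edges) (hne : G.inc (e, false) ≠ G.inc (e, true))
    (ht : ¬ G.Twisted e) : (G.merge e he hne).eulerChar = G.eulerChar := by
  have hverts := card_verts_merge he hne
  have hedges : (G.merge e he hne).edges.card + 1 = G.edges.card := Finset.card_erase_add_one he
  rw [eulerChar, eulerChar, card_face_merge he hne ht]
  omega

end Merge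

section Connectivity

variable {G : RibbonGraph V E} {S : Finset E}

theorem simpleGraph_adj {u v : {v // v ∈ G.verts}} :
    (G.simpleGraph S).Adj u v ↔ u ≠ v ∧ ∃ e ∈ S, G.ends e = s(u.1, v.1) := by
  simp only [simpleGraph, SimpleGraph.fromRel_adj, Sym2.eq_swap (a := v.1), or_self]

theorem reachable_simpleGraph {e : E} (he : e ∈ S) (hG : e ∈ G.edges) :
    (G.simpleGraph S).Reachable ⟨_, G.inc_mem (e, false) hG⟩ ⟨_, G.inc_mem (e, true) hG⟩ := by
  by_cases h : G.inc (e, false) = G.inc (e, true)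
  · simp only [h, SimpleGraph.Reachable.refl]
  · exact (simpleGraph_adj.2 ⟨fun h' => h (congrArg Subtype.val h'), e, he, rfl⟩).reachable

theorem connected_of_surjective_of_reachable {W : Type*} {H : SimpleGraph W} (hS : S ⊆ G.edges)
    (hconn : (G.simpleGraph S).Connected) (φ : {v // v ∈ G.verts} → W)
    (hφ : Function.Surjective φ)
    (hreach : ∀ e (he : e ∈ S), H.Reachable (φ ⟨_, G.inc_mem (e, false) (hS he)⟩)
      (φ ⟨_, G.inc_mem (e, true) (hS he)⟩)) : H.Connected := by
  have hadj : ∀ u v, (G.simpleGraph S).Adj u v → H.Reachable (φ u) (φ v) := by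
    rintro ⟨u, hu⟩ ⟨v, hv⟩ huv
    obtain ⟨-, e, he, hends⟩ := simpleGraph_adj.1 huv
    obtain ⟨rfl, rfl⟩ | ⟨rfl, rfl⟩ := Sym2.eq_iff.1 hends
    exacts [hreach e he, (hreach e he).symm]
  have hwalk : ∀ u v, H.Reachable (φ u) (φ v) := fun u v => by
    obtain ⟨p⟩ := hconn.preconnected u v
    induction p with
    | nil => rfl
    | cons h _ ih => exact (hadj _ _ h).trans ih
  have := hconn.nonempty.map φ
  exact ⟨hφ.forall₂.2 hwalk⟩

theorem image_edgeSet_simpleGraph (hS : S ⊆ G.edges) :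
    Sym2.map Subtype.val '' (G.simpleGraph S).edgeSet = {p ∈ G.ends '' S | ¬ p.IsDiag} := by
  ext p
  constructor
  · rintro ⟨q, hq, rfl⟩
    induction q with | _ u v
    obtain ⟨hne, e, he, hends⟩ := simpleGraph_adj.1 hq
    exact ⟨⟨e, he, hends⟩, fun h => hne (Subtype.ext h)⟩
  · rintro ⟨⟨e, he, rfl⟩, hdiag⟩
    exact ⟨s(⟨_, G.inc_mem (e, false) (hS he)⟩, ⟨_, G.inc_mem (e, true) (hS he)⟩),
      simpleGraph_adj.2 ⟨fun h => hdiag (congrArg Subtype.val h), e, he, rfl⟩, rfl⟩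

theorem ncard_edgeSet_simpleGraph (hS : S ⊆ G.edges) :
    (G.simpleGraph S).edgeSet.ncard = {p ∈ G.ends '' S | ¬ p.IsDiag}.ncard := by
  rw [← image_edgeSet_simpleGraph hS,
    Set.ncard_image_of_injective _ (Sym2.map.injective Subtype.val_injective)]

theorem card_verts_le_of_connected (hS : S ⊆ G.edges) (hconn : (G.simpleGraph S).Connected) :
    G.verts.card ≤ S.card + 1 := by
  have hle := hconn.card_vert_le_card_edgeSet_add_one
  rw [Nat.card_coe_set_eq, ncard_edgeSet_simpleGraph hS, Nat.card_eq_fintype_card,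
    Fintype.card_coe] at hle
  have hsub : {p ∈ G.ends '' S | ¬ p.IsDiag}.ncard ≤ S.card :=
    (Set.ncard_le_ncard (Set.sep_subset _ _) (S.finite_toSet.image _)).trans <|
      (Set.ncard_image_le S.finite_toSet).trans_eq (Set.ncard_coe_finset S)
  omega

theorem IsSpanningTree.card_verts (hS : G.IsSpanningTree S) : G.verts.card = S.card + 1 := by
  classical
  have hends : {p ∈ G.ends '' S | ¬ p.IsDiag} = G.ends '' S :=
    Set.sep_eq_self_iff_mem_true.2 (Set.forall_mem_image.2 hS.not_loop)
  have htree := hS.isTree.card_edgeFinset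
  rw [SimpleGraph.edgeFinset, ← Set.ncard_eq_toFinset_card', ncard_edgeSet_simpleGraph hS.subset,
    hends, hS.not_parallel.ncard_image, Set.ncard_coe_finset, Fintype.card_coe] at htree
  exact htree.symm

/-- `S` is a smallest set of edges that connects all vertex-discs of `G`. In contrast to
`IsSpanningTree`, this only asks for connectedness and the number of edges, which is what
contraction visibly preserves. -/
structure MinimallyConnects (G : RibbonGraph V E) (S : Finset E) : Prop where
  subset : S ⊆ G.edges
  connected : (G.simpleGraph S).Connected
  card_verts : G.verts.card = S.card + 1

theorem IsSpanningTree.minimallyConnects (hS : G.IsSpanningTree S) : G.MinimallyConnects S :=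
  ⟨hS.subset, hS.isTree.connected, hS.card_verts⟩

theorem MinimallyConnects.inc_ne (hS : G.MinimallyConnects S) {e : E} (he : e ∈ S) :
    G.inc (e, false) ≠ G.inc (e, true) := fun hloop => by
  classical
  have hsub : S.erase e ⊆ G.edges := (Finset.erase_subset e S).trans hS.subset
  have hconn : (G.simpleGraph (S.erase e)).Connected := by
    refine connected_of_surjective_of_reachable hS.subset hS.connected id
      Function.surjective_id fun x hx => ?_
    by_cases hxe : x = e
    · subst hxe
      simp only [hloop, id, SimpleGraph.Reachable.refl]
    · exact reachable_simpleGraph (Finset.mem_erase.2 ⟨hxe, hx⟩) (hS.subset hx)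
  have hle := card_verts_le_of_connected hsub hconn
  have hlt := Finset.card_erase_lt_of_mem he
  have := hS.card_verts
  omega

theorem MinimallyConnects.connected_graph (hS : G.MinimallyConnects S) : G.Connected :=
  connected_of_surjective_of_reachable hS.subset hS.connected id Function.surjective_id
    fun _ hx => reachable_simpleGraph (hS.subset hx) (hS.subset hx)

theorem Connected.numComponents (hG : G.Connected) : G.numComponents = 1 :=
  Nat.card_eq_one_iff_unique.2 ⟨hG.preconnected.subsingleton_connectedComponent,
    hG.nonempty.map (SimpleGraph.connectedComponentMk _)⟩

theorem Connected.eulerGenus (hG : G.Connected) : G.eulerGenus = 2 - G.eulerChar := by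
  rw [RibbonGraph.eulerGenus, hG.numComponents, Nat.cast_one, mul_one]

end Connectivity

section Contract

variable [DecidableEq V] {G : RibbonGraph V E} {S : Finset E} {e : E}

open Classical in
/-- `G` with the orientation of one end-disc of the edge `e` reversed if this is needed to make `e`
untwisted. -/
noncomputable def untwist (G : RibbonGraph V E) (e : E) : RibbonGraph V E :=
  if G.Twisted e then G.flip (G.inc (e, true)) else G

theorem edges_untwist (G : RibbonGraph V E) (e : E) : (G.untwist e).edges = G.edges := by
  unfold untwist
  split_ifs <;> rfl

theorem inc_untwist (G : RibbonGraph V E) (e : E) : (G.untwist e).inc = G.inc := by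
  unfold untwist
  split_ifs <;> rfl

theorem not_twisted_untwist (hne : G.inc (e, false) ≠ G.inc (e, true)) :
    ¬ (G.untwist e).Twisted e := by
  unfold untwist
  split_ifs with ht
  · simp [flip_twisted_iff, ht, hne]
  · exact ht

theorem eulerChar_untwist (G : RibbonGraph V E) (e : E) :
    (G.untwist e).eulerChar = G.eulerChar := by
  unfold untwist
  split_ifs
  · exact G.eulerChar_flip _
  · rfl

theorem MinimallyConnects.untwist (hS : G.MinimallyConnects S) (e : E) :
    (G.untwist e).MinimallyConnects S := by
  unfold RibbonGraph.untwist
  split_ifs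
  · exact ⟨hS.subset, hS.connected, hS.card_verts⟩
  · exact hS

variable [DecidableEq E]

theorem MinimallyConnects.merge (hS : G.MinimallyConnects S) (heS : e ∈ S) (he : e ∈ G.edges)
    (hne : G.inc (e, false) ≠ G.inc (e, true)) :
    (G.merge e he hne).MinimallyConnects (S.erase e) := by
  have hsub : S.erase e ⊆ (G.merge e he hne).edges := Finset.erase_subset_erase e hS.subset
  refine ⟨hsub, ?_, ?_⟩
  · let φ (v : {v // v ∈ G.verts}) : {v // v ∈ (G.merge e he hne).verts} :=
      if hv : v.1 = G.inc (e, true) then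
        ⟨_, Finset.mem_erase.2 ⟨hne, G.inc_mem (e, false) he⟩⟩
      else ⟨v, Finset.mem_erase.2 ⟨hv, v.2⟩⟩
    have hφ : ∀ h (hh : h.1 ∈ G.edges),
        (φ ⟨_, G.inc_mem h hh⟩).1 = (G.merge e he hne).inc h := fun h hh => by
      rw [inc_merge]
      simp only [φ]
      split_ifs <;> rfl
    refine connected_of_surjective_of_reachable hS.subset hS.connected φ (fun v => ?_)
      fun x hx => ?_
    · obtain ⟨hvt, hv⟩ := Finset.mem_erase.1 v.2
      exact ⟨⟨v, hv⟩, dif_neg hvt⟩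
    · by_cases hxe : x = e
      · subst hxe
        have hends : φ ⟨_, G.inc_mem (x, false) he⟩ = φ ⟨_, G.inc_mem (x, true) he⟩ :=
          Subtype.ext (by rw [hφ _ he, hφ _ he, inc_merge, inc_merge, if_neg hne, if_pos rfl])
        rw [hends]
      · have hxS : x ∈ S.erase e := Finset.mem_erase.2 ⟨hxe, hx⟩
        convert reachable_simpleGraph hxS (hsub hxS) using 1
        exacts [Subtype.ext (hφ _ (hS.subset hx)), Subtype.ext (hφ _ (hS.subset hx))]
  · have hverts := card_verts_merge he hne
    have hcard := Finset.card_erase_add_one heS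
    have := hS.card_verts
    omega

theorem contract_eq_merge (he : e ∈ (G.untwist e).edges)
    (hne : (G.untwist e).inc (e, false) ≠ (G.untwist e).inc (e, true)) :
    G.contract e = (G.untwist e).merge e he hne := by
  have hG : e ∈ G.edges ∧ G.inc (e, false) ≠ G.inc (e, true) :=
    ⟨G.edges_untwist e ▸ he, G.inc_untwist e ▸ hne⟩
  rw [contract, dif_pos hG]
  split_ifs with ht <;> simp only [untwist, ht, if_true, if_false]

theorem MinimallyConnects.exists_contract_eq (hS : G.MinimallyConnects S) (he : e ∈ S) :
    ∃ (he' : e ∈ (G.untwist e).edges)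
      (hne : (G.untwist e).inc (e, false) ≠ (G.untwist e).inc (e, true)),
      G.contract e = (G.untwist e).merge e he' hne :=
  have hS' := hS.untwist e
  ⟨hS'.subset he, hS'.inc_ne he, contract_eq_merge _ _⟩

theorem MinimallyConnects.contract (hS : G.MinimallyConnects S) (he : e ∈ S) :
    (G.contract e).MinimallyConnects (S.erase e) := by
  obtain ⟨he', hne, heq⟩ := hS.exists_contract_eq he
  rw [heq]
  exact (hS.untwist e).merge he he' hne

theorem MinimallyConnects.edges_contract (hS : G.MinimallyConnects S) (he : e ∈ S) :
    (G.contract e).edges = G.edges.erase e := by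
  obtain ⟨he', hne, heq⟩ := hS.exists_contract_eq he
  rw [heq, ← G.edges_untwist e]
  rfl

theorem MinimallyConnects.eulerChar_contract (hS : G.MinimallyConnects S) (he : e ∈ S) :
    (G.contract e).eulerChar = G.eulerChar := by
  obtain ⟨he', hne, heq⟩ := hS.exists_contract_eq he
  rw [heq, eulerChar_merge he' hne (not_twisted_untwist (hS.inc_ne he)), eulerChar_untwist]

theorem MinimallyConnects.contract_of_cons {l : List E} (hl : (e :: l).Nodup)
    (hS : G.MinimallyConnects (e :: l).toFinset) :
    (G.contract e).MinimallyConnects l.toFinset := by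
  have hel : e ∉ l.toFinset := fun h => (List.nodup_cons.1 hl).1 (List.mem_toFinset.1 h)
  rw [List.toFinset_cons] at hS
  simpa only [Finset.erase_insert hel] using hS.contract (Finset.mem_insert_self e _)

theorem MinimallyConnects.aux {l : List E} (hl : l.Nodup) (hS : G.MinimallyConnects l.toFinset) :
    (G.aux l).MinimallyConnects ∅ := by
  induction l generalizing G with
  | nil => exact hS
  | cons e l ih => exact ih hl.of_cons (hS.contract_of_cons hl)

theorem MinimallyConnects.edges_aux {l : List E} (hl : l.Nodup)
    (hS : G.MinimallyConnects l.toFinset) : (G.aux l).edges = G.edges \ l.toFinset := by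
  induction l generalizing G with
  | nil => exact Finset.sdiff_empty.symm
  | cons e l ih =>
    refine (ih hl.of_cons (hS.contract_of_cons hl)).trans ?_
    rw [hS.edges_contract (by simp), Finset.erase_sdiff_comm, List.toFinset_cons,
      Finset.sdiff_insert]

theorem MinimallyConnects.eulerChar_aux {l : List E} (hl : l.Nodup)
    (hS : G.MinimallyConnects l.toFinset) : (G.aux l).eulerChar = G.eulerChar := by
  induction l generalizing G with
  | nil => rfl
  | cons e l ih =>
    exact (ih hl.of_cons (hS.contract_of_cons hl)).trans (hS.eulerChar_contract (by simp))

theorem MinimallyConnects.eulerGenus_aux {l : List E} (hl : l.Nodup)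
    (hS : G.MinimallyConnects l.toFinset) : (G.aux l).eulerGenus = G.eulerGenus := by
  rw [(hS.aux hl).connected_graph.eulerGenus, hS.connected_graph.eulerGenus, hS.eulerChar_aux hl]

end Contract

section CyclicPosition

theorem mod_of_lt_two_mul {a n : ℕ} (ha : a < 2 * n) : a % n = if a < n then a else a - n := by
  split_ifs with h
  · exact Nat.mod_eq_of_lt h
  · rw [Nat.mod_eq_sub_mod (by omega), Nat.mod_eq_of_lt (by omega)]

variable {α : Type*} {π : Equiv.Perm α} {s : Finset α} {pos : α → ℕ}

/-- `pos` numbers the elements of `s` by `0, …, #s - 1` along the cycle of `π` on `s`. -/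
structure IsCyclicPosition (π : Equiv.Perm α) (s : Finset α) (pos : α → ℕ) : Prop where
  apply_mem : ∀ x ∈ s, π x ∈ s
  lt : ∀ x ∈ s, pos x < s.card
  injOn : Set.InjOn pos s
  pos_apply : ∀ x ∈ s, pos (π x) = (pos x + 1) % s.card

theorem apply_eq_of_isCycleOn {β : Type*} {f : α → β} (hπ : π.IsCycleOn s)
    (hf : ∀ x ∈ s, f (π x) = f x) {x y : α} (hx : x ∈ s) (hy : y ∈ s) : f x = f y := by
  have hpow : ∀ n : ℕ, (π ^ n) x ∈ s ∧ f ((π ^ n) x) = f x := fun n => by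
    induction n with
    | zero => exact ⟨hx, rfl⟩
    | succ n ih =>
      rw [pow_succ', Equiv.Perm.mul_apply]
      exact ⟨hπ.apply_mem_iff.2 ih.1, (hf _ ih.1).trans ih.2⟩
  obtain ⟨n, -, rfl⟩ := hπ.exists_pow_eq hx hy
  exact (hpow n).2.symm

theorem exists_isCyclicPosition (hπ : π.IsCycleOn s) : ∃ pos, IsCyclicPosition π s pos := by
  obtain rfl | ⟨a, ha⟩ := s.eq_empty_or_nonempty
  · exact ⟨fun _ => 0, by simp, by simp, by simp, by simp⟩
  choose! pos hlt hpow using fun (x : α) (hx : x ∈ s) => hπ.exists_pow_eq ha hx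
  have hmem : ∀ x ∈ s, π x ∈ s := fun x hx => hπ.apply_mem_iff.2 hx
  refine ⟨pos, hmem, hlt, fun x hx y hy hxy => ?_, fun x hx => ?_⟩
  · rw [← hpow x hx, hxy, hpow y hy]
  · have hmod : (π ^ pos (π x)) a = (π ^ (pos x + 1)) a := by
      rw [hpow _ (hmem x hx), pow_succ', Equiv.Perm.mul_apply, hpow x hx]
    rw [← Nat.mod_eq_of_lt (hlt _ (hmem x hx))]
    exact (hπ.pow_apply_eq_pow_apply ha).1 hmod

namespace IsCyclicPosition

theorem pow_apply_mem (H : IsCyclicPosition π s pos) {x : α} (hx : x ∈ s) (n : ℕ) :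
    (π ^ n) x ∈ s := by
  induction n with
  | zero => exact hx
  | succ n ih => rw [pow_succ', Equiv.Perm.mul_apply]; exact H.apply_mem _ ih

theorem pos_pow_apply (H : IsCyclicPosition π s pos) {x : α} (hx : x ∈ s) (n : ℕ) :
    pos ((π ^ n) x) = (pos x + n) % s.card := by
  induction n with
  | zero => exact (Nat.mod_eq_of_lt (H.lt x hx)).symm
  | succ n ih =>
    rw [pow_succ', Equiv.Perm.mul_apply, H.pos_apply _ (H.pow_apply_mem hx n), ih, Nat.mod_add_mod,
      add_assoc]

theorem pow_apply_eq_iff (H : IsCyclicPosition π s pos) {x y : α} (hx : x ∈ s) (hy : y ∈ s)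
    (n : ℕ) : (π ^ n) x = y ↔ (pos x + n) % s.card = pos y := by
  rw [← H.pos_pow_apply hx, H.injOn.eq_iff (H.pow_apply_mem hx n) hy]

theorem sum_lt_pos_apply {M : Type*} [AddCommMonoid M] (H : IsCyclicPosition π s pos) {f : α → M}
    (hf : ∑ y ∈ s, f y = 0) {x : α} (hx : x ∈ s) :
    ∑ y ∈ s with pos y < pos (π x), f y = ∑ y ∈ s with pos y < pos x, f y + f x := by
  classical
  have hle : {y ∈ s | pos y ≤ pos x} = insert x {y ∈ s | pos y < pos x} := by
    ext y
    rw [Finset.mem_insert, Finset.mem_filter, Finset.mem_filter, le_iff_eq_or_lt, and_or_left]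
    exact or_congr_left ⟨fun h => H.injOn h.1 hx h.2, fun h => ⟨h ▸ hx, congrArg pos h⟩⟩
  have hstep : ∑ y ∈ s with pos y < pos x, f y + f x = ∑ y ∈ s with pos y ≤ pos x, f y := by
    rw [hle, Finset.sum_insert (by simp), add_comm]
  rw [hstep, H.pos_apply x hx]
  obtain hlt | heq := (Nat.succ_le_of_lt (H.lt x hx)).lt_or_eq
  · simp only [Nat.mod_eq_of_lt hlt, Nat.lt_succ_iff]
  · rw [← Nat.succ_eq_add_one, heq, Nat.mod_self]
    have hall : {y ∈ s | pos y ≤ pos x} = s :=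
      Finset.filter_true_of_mem fun y hy => Nat.lt_succ_iff.1 (heq ▸ H.lt y hy)
    rw [hall, hf]
    simp

theorem meets_iff {B : RibbonGraph V E} {s : Finset (E × Bool)} {pos : E × Bool → ℕ}
    (H : IsCyclicPosition B.next s pos) {x y z : E × Bool} (hx : x ∈ s) (hy : y ∈ s) (hz : z ∈ s)
    (hxz : x ≠ z) :
    B.Meets x y z ↔ pos x < pos y ∧ pos y < pos z ∨ pos y < pos z ∧ pos z < pos x ∨
      pos z < pos x ∧ pos x < pos y := by
  have hpx := H.lt x hx
  have hpy := H.lt y hy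
  have hpz := H.lt z hz
  have hpxz := H.injOn.ne hx hz hxz
  simp only [Meets, H.pow_apply_eq_iff hx hy, ne_eq, H.pow_apply_eq_iff hx hz]
  generalize pos x = a, pos y = b, pos z = c, s.card = N at *
  constructor
  · rintro ⟨j, hj, hjy, hjz⟩
    have hlt : j < if a < c then c - a else c + N - a := by
      by_contra! hle
      refine hjz _ ?_ hle ?_
      · split_ifs <;> omega
      · rw [mod_of_lt_two_mul (by split_ifs <;> omega)]
        split_ifs <;> omega
    rw [mod_of_lt_two_mul (by split_ifs at hlt <;> omega)] at hjy
    split_ifs at hjy hlt <;> omega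
  · intro horder
    refine ⟨if a < b then b - a else b + N - a, ?_, ?_, fun i hi hib => ?_⟩
    · split_ifs <;> omega
    · rw [mod_of_lt_two_mul (by split_ifs <;> omega)]
      split_ifs <;> omega
    · rw [mod_of_lt_two_mul (by split_ifs at hib <;> omega)]
      split_ifs at hib ⊢ <;> omega

end IsCyclicPosition

end CyclicPosition

section Crossing

variable {B : RibbonGraph V E} {s : Finset (E × Bool)} {pos : E × Bool → ℕ}

theorem IsCyclicPosition.interlaced_iff (H : IsCyclicPosition B.next s pos) {e f : E}
    (he : ∀ i, (e, i) ∈ s) (hf : ∀ j, (f, j) ∈ s) (hef : e ≠ f) :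
    B.Interlaced e f ↔
      ¬ ((pos (f, false) < pos (e, false) ↔ pos (f, false) < pos (e, true)) ↔
        (pos (f, true) < pos (e, false) ↔ pos (f, true) < pos (e, true))) := by
  have hne : ∀ i j, pos (e, i) ≠ pos (f, j) := fun i j =>
    H.injOn.ne (he i) (hf j) (by simp [hef])
  have hefe : ∀ i j, B.Meets (e, i) (f, j) (e, !i) ↔ _ := fun i j =>
    H.meets_iff (he i) (hf j) (he _) (by simp)
  have hfef : ∀ i j, B.Meets (f, j) (e, i) (f, !j) ↔ _ := fun i j =>
    H.meets_iff (hf j) (he i) (hf _) (by simp)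
  have hefe' : ∀ i j, B.Meets (e, !i) (f, !j) (e, i) ↔ _ := fun i j => by
    simpa only [Bool.not_not] using hefe (!i) (!j)
  have hfef' : ∀ i j, B.Meets (f, !j) (e, i) (f, j) ↔ _ := fun i j => by
    simpa only [Bool.not_not] using hfef i (!j)
  simp only [Interlaced, InCyclicOrder, hefe, hfef _ _, hefe', hfef', Bool.exists_bool,
    Bool.not_true, Bool.not_false]
  have hac := hne false false
  have had := hne false true
  have hbc := hne true false
  have hbd := hne true true
  generalize pos (e, false) = a, pos (e, true) = b, pos (f, false) = c, pos (f, true) = d at *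
  clear hne hefe hfef hefe' hfef' he hf
  constructor
  · rintro ((⟨h, -, h', -⟩ | ⟨h, -, h', -⟩) | (⟨h, -, h', -⟩ | ⟨h, -, h', -⟩)) <;> omega
  · intro hcross
    obtain hac | hac := hac.lt_or_gt <;> obtain had | had := had.lt_or_gt <;>
    obtain hbc | hbc := hbc.lt_or_gt <;> obtain hbd | hbd := hbd.lt_or_gt <;>
    simp only [hac, had, hbc, hbd, hac.not_gt, had.not_gt, hbc.not_gt, hbd.not_gt, iff_self,
      iff_true, iff_false, not_true_eq_false, true_and, false_and, and_true, and_false, true_or,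
      false_or, or_false] at hcross ⊢ <;> omega

end Crossing

section Bouquet

/-- The half-edges of the edges of `B`. -/
def halfEdges (B : RibbonGraph V E) : Finset (E × Bool) := B.edges ×ˢ Finset.univ

variable {B : RibbonGraph V E} {pos : E × Bool → ℕ}

theorem mem_halfEdges {h : E × Bool} : h ∈ B.halfEdges ↔ h.1 ∈ B.edges := by
  simp [halfEdges]

theorem IsBouquet.isCycleOn_halfEdges (hB : B.IsBouquet) : B.next.IsCycleOn B.halfEdges := by
  have hinc : ∀ {h k : E × Bool}, h.1 ∈ B.edges → k.1 ∈ B.edges → B.inc h = B.inc k :=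
    fun hh hk => Finset.card_le_one.1 hB.le _ (B.inc_mem _ hh) _ (B.inc_mem _ hk)
  have hmaps : Set.MapsTo B.next B.halfEdges B.halfEdges := fun h hh =>
    mem_halfEdges.2 (B.next_mem (mem_halfEdges.1 hh))
  refine ⟨(Finset.finite_toSet _).injOn_iff_bijOn_of_mapsTo hmaps |>.1 B.next.injective.injOn,
    fun h hh k hk => ?_⟩
  rw [Finset.mem_coe, mem_halfEdges] at hh hk
  exact B.sameCycle_of_inc_eq h k hh hk (hinc hh hk)

/-- The sum of the labels `x` of the half-edges that precede `h` in the rotation of a bouquet. -/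
def height (B : RibbonGraph V E) (pos : E × Bool → ℕ) (x : E → ZMod 2) (h : E × Bool) : ZMod 2 :=
  ∑ k ∈ B.halfEdges with pos k < pos h, x k.1

theorem height_next (H : IsCyclicPosition B.next B.halfEdges pos) (x : E → ZMod 2) {h : E × Bool}
    (hh : h.1 ∈ B.edges) : B.height pos x (B.next h) = B.height pos x h + x h.1 := by
  refine H.sum_lt_pos_apply (f := fun k => x k.1) ?_ (mem_halfEdges.2 hh)
  rw [halfEdges, Finset.sum_product]
  simp [CharTwo.two_eq_zero]

open Classical in
theorem card_between (H : IsCyclicPosition B.next B.halfEdges pos) {e f : E} (he : e ∈ B.edges)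
    (hf : f ∈ B.edges) :
    (∑ j, if pos (f, j) < pos (e, false) then 1 else 0 : ZMod 2) +
      (∑ j, if pos (f, j) < pos (e, true) then 1 else 0) =
      if e = f ∨ B.Interlaced e f then 1 else 0 := by
  obtain rfl | hef := eq_or_ne e f
  · have hne : pos (e, false) ≠ pos (e, true) :=
      H.injOn.ne (mem_halfEdges.2 he) (mem_halfEdges.2 he) (by simp)
    rw [Fintype.sum_bool, Fintype.sum_bool, if_pos (Or.inl rfl)]
    obtain hlt | hlt := hne.lt_or_gt <;> simp [hlt, hlt.not_gt]
  · simp only [H.interlaced_iff (fun _ => mem_halfEdges.2 he) (fun _ => mem_halfEdges.2 hf) hef,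
      hef, false_or, Fintype.sum_bool]
    by_cases h₁ : pos (f, false) < pos (e, false) <;>
    by_cases h₂ : pos (f, false) < pos (e, true) <;>
    by_cases h₃ : pos (f, true) < pos (e, false) <;>
    by_cases h₄ : pos (f, true) < pos (e, true) <;>
    simp only [h₁, h₂, h₃, h₄, if_true, if_false] <;> decide

open Classical in
theorem height_add_height (H : IsCyclicPosition B.next B.halfEdges pos) (x : E → ZMod 2) {e : E}
    (he : e ∈ B.edges) : B.height pos x (e, false) + B.height pos x (e, true) =
      ∑ f ∈ B.edges, if e = f ∨ B.Interlaced e f then x f else 0 := by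
  have hheight : ∀ h, B.height pos x h =
      ∑ f ∈ B.edges, (∑ j, if pos (f, j) < pos h then 1 else 0) * x f := fun h => by
    rw [height, Finset.sum_filter, halfEdges, Finset.sum_product]
    simp only [Finset.sum_mul, ite_mul, one_mul, zero_mul]
  rw [hheight, hheight, ← Finset.sum_add_distrib]
  refine Finset.sum_congr rfl fun f hf => ?_
  rw [← add_mul, card_between H he hf, ite_mul, one_mul, zero_mul]

open Classical in
theorem signedIntersectionGraph_adj_apply (e f : {e // e ∈ B.edges}) :
    B.signedIntersectionGraph.adj e f =
      (if e.1 = f ∨ B.Interlaced e f then 1 else 0) + if e = f ∧ ¬ B.Twisted e then 1 else 0 := by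
  simp only [SignedGraph.adj, Matrix.add_apply, SimpleGraph.adjMatrix_apply, Matrix.diagonal,
    Matrix.of_apply]
  obtain rfl | hef := eq_or_ne e f
  · by_cases ht : B.Twisted e <;>
      simp [signedIntersectionGraph, ht, CharTwo.add_self_eq_zero]
  · simp [signedIntersectionGraph, intersectionGraph, hef, Subtype.coe_injective.ne hef]

open Classical in
theorem adj_mulVec (H : IsCyclicPosition B.next B.halfEdges pos) (x : E → ZMod 2)
    (e : {e // e ∈ B.edges}) :
    B.signedIntersectionGraph.adj.mulVec (fun f => x f) e =
      B.height pos x (e, false) + B.height pos x (e, true) + if B.Twisted e then 0 else x e := by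
  simp only [Matrix.mulVec, dotProduct, signedIntersectionGraph_adj_apply, add_mul,
    Finset.sum_add_distrib]
  congr 1
  · rw [height_add_height H x e.2, ← Finset.sum_coe_sort B.edges]
    simp only [ite_mul, one_mul, zero_mul]
  · by_cases ht : B.Twisted e <;> simp [ht]

end Bouquet

section BouquetColouring

variable {B : RibbonGraph V E} {pos : E × Bool → ℕ} {c : (E × Bool) × Bool → ZMod 2}

/-- The difference of the colours of the two sides of the ribbon `e`, read off at `(e, false)`. -/
def sideDiff (c : (E × Bool) × Bool → ZMod 2) (e : E) : ZMod 2 :=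
  c ((e, false), true) - c ((e, false), false)

theorem IsBoundaryColouring.apply_true (hc : B.IsBoundaryColouring c) (h : E × Bool) :
    c (h, true) = c (h, false) + sideDiff c h.1 := by
  obtain ⟨e, _ | _⟩ := h
  · exact (add_sub_cancel _ _).symm
  · have hfalse := hc.side e true false
    have htrue := hc.side e true true
    rw [← hfalse, ← htrue, sideDiff, oppositeSide, oppositeSide]
    split_ifs
    · exact (add_sub_cancel _ _).symm
    · rw [CharTwo.sub_eq_add, Bool.not_true, Bool.not_false, CharTwo.add_cancel_left]

open Classical in
/-- The colouring of the corners of a bouquet in which the first corner of the rotation has colour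
`t` and the two sides of each ribbon `e` differ by `x e`. -/
noncomputable def colour (B : RibbonGraph V E) (pos : E × Bool → ℕ) (t : ZMod 2) (x : E → ZMod 2)
    (p : (E × Bool) × Bool) : ZMod 2 :=
  if p.1.1 ∈ B.edges then t + B.height pos x p.1 + if p.2 then x p.1.1 else 0 else 0

theorem sideDiff_colour (t : ZMod 2) (x : E → ZMod 2) {e : E} (he : e ∈ B.edges) :
    sideDiff (B.colour pos t x) e = x e := by
  simp [sideDiff, colour, he]

theorem isBoundaryColouring_colour_iff (H : IsCyclicPosition B.next B.halfEdges pos) (t : ZMod 2)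
    (x : E → ZMod 2) : B.IsBoundaryColouring (B.colour pos t x) ↔
      B.signedIntersectionGraph.adj.mulVec (fun f => x f) = 0 := by
  have hside : ∀ (e : {e // e ∈ B.edges}) (j i : Bool),
      B.colour pos t x ((e, !j), B.oppositeSide e i) - B.colour pos t x ((e, j), i) =
        B.signedIntersectionGraph.adj.mulVec (fun f => x f) e := fun e j i => by
    rw [adj_mulVec H, colour, colour, if_pos e.2, if_pos e.2, oppositeSide]
    cases j <;> cases i <;> by_cases ht : B.Twisted e <;>
    simp only [ht, if_true, if_false, Bool.not_true, Bool.not_false, Bool.false_eq_true] <;>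
    generalize B.height pos x (e, false) = a, B.height pos x (e, true) = b, x e = y <;>
    revert t a b y <;> decide
  constructor
  · intro hc
    ext e
    rw [← hside e false false, hc.side, sub_self, Pi.zero_apply]
  · intro hx
    refine ⟨fun p hp => if_neg hp, fun h => ?_, fun e j i => ?_⟩
    · by_cases hh : h.1 ∈ B.edges
      · simp [colour, hh, B.next_mem hh, height_next H x hh, add_assoc]
      · rw [B.next_of_notMem h hh, colour, colour, if_neg hh, if_neg hh]
    · by_cases he : e ∈ B.edges
      · rw [← sub_eq_zero, hside ⟨e, he⟩, hx, Pi.zero_apply]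
      · rw [colour, colour, if_neg he, if_neg he]

theorem IsBoundaryColouring.exists_eq_colour (hB : B.IsBouquet)
    (H : IsCyclicPosition B.next B.halfEdges pos) (hc : B.IsBoundaryColouring c) :
    ∃ t, c = B.colour pos t (sideDiff c) := by
  obtain ⟨t, ht⟩ : ∃ t, ∀ h : E × Bool, h.1 ∈ B.edges →
      c (h, false) - B.height pos (sideDiff c) h = t := by
    obtain hE | ⟨h₀, hh₀⟩ := B.halfEdges.eq_empty_or_nonempty
    · exact ⟨0, fun h hh => by simp [← mem_halfEdges, hE] at hh⟩
    have hstep : ∀ h ∈ B.halfEdges, c (B.next h, false) - B.height pos (sideDiff c) (B.next h) =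
        c (h, false) - B.height pos (sideDiff c) h := fun h hh => by
      rw [height_next H _ (mem_halfEdges.1 hh), hc.arc, hc.apply_true, add_sub_add_right_eq_sub]
    exact ⟨_, fun h hh => apply_eq_of_isCycleOn
      (f := fun h => c (h, false) - B.height pos (sideDiff c) h) hB.isCycleOn_halfEdges hstep
      (mem_halfEdges.2 hh) hh₀⟩
  refine ⟨t, ?_⟩
  ext ⟨h, i⟩
  by_cases hh : h.1 ∈ B.edges
  · simp only [colour, hh, if_true]
    rw [← ht h hh, sub_add_cancel]
    cases i
    · simp
    · simp [hc.apply_true h]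
  · rw [hc.eq_zero _ hh, colour, if_neg hh]

/-- The map `c ↦ sideDiff c` on the space of boundary colourings, restricted to the edges of `B`. -/
def sideDiffMap (B : RibbonGraph V E) :
    B.boundaryColourings →ₗ[ZMod 2] {e // e ∈ B.edges} → ZMod 2 where
  toFun c e := sideDiff c.1 e
  map_add' c d := by
    ext e
    exact add_sub_add_comm _ _ _ _
  map_smul' a c := by
    ext e
    exact (mul_sub a _ _).symm

theorem IsBouquet.range_sideDiffMap (hB : B.IsBouquet) :
    LinearMap.range B.sideDiffMap = LinearMap.ker B.signedIntersectionGraph.adj.mulVecLin := by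
  obtain ⟨pos, H⟩ := exists_isCyclicPosition hB.isCycleOn_halfEdges
  ext y
  rw [LinearMap.mem_ker, Matrix.mulVecLin_apply]
  constructor
  · rintro ⟨⟨c, hc⟩, rfl⟩
    obtain ⟨t, ht⟩ := hc.exists_eq_colour hB H
    exact (isBoundaryColouring_colour_iff H t _).1 (ht ▸ hc)
  · intro hy
    obtain ⟨x, rfl⟩ : ∃ x : E → ZMod 2, (fun e : {e // e ∈ B.edges} => x e) = y :=
      ⟨Function.extend Subtype.val y 0, funext (Subtype.val_injective.extend_apply y 0)⟩
    exact ⟨⟨_, (isBoundaryColouring_colour_iff H 0 x).2 hy⟩,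
      funext fun e => sideDiff_colour 0 x e.2⟩

theorem smul_colour_zero (t : ZMod 2) : t • B.colour pos 1 0 = B.colour pos t 0 := by
  ext p
  simp [colour, height]

theorem IsBouquet.finrank_ker_sideDiffMap (hB : B.IsBouquet) (hE : B.edges.Nonempty) :
    Module.finrank (ZMod 2) (LinearMap.ker B.sideDiffMap) = 1 := by
  obtain ⟨pos, H⟩ := exists_isCyclicPosition hB.isCycleOn_halfEdges
  obtain ⟨e₀, he₀⟩ := hE
  have hconst : B.IsBoundaryColouring (B.colour pos 1 0) :=
    (isBoundaryColouring_colour_iff H 1 0).2 (Matrix.mulVec_zero _)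
  refine finrank_eq_one (⟨⟨_, hconst⟩, ?_⟩ : LinearMap.ker B.sideDiffMap) ?_ ?_
  · exact funext fun e => sideDiff_colour 1 0 e.2
  · intro h
    have := congrFun (congrArg (fun c => c.1.1) h) ((e₀, false), false)
    simp [colour, he₀, height] at this
  · rintro ⟨⟨c, hc⟩, hker⟩
    obtain ⟨t, ht⟩ := hc.exists_eq_colour hB H
    have hzero : sideDiff c = 0 := funext fun e => by
      by_cases he : e ∈ B.edges
      · exact congrFun hker ⟨e, he⟩
      · simp [sideDiff, hc.eq_zero ((e, _), _) he]
    refine ⟨t, Subtype.ext (Subtype.ext ?_)⟩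
    rw [hzero] at ht
    exact (smul_colour_zero t).trans ht.symm

theorem IsBouquet.isolatedVerts_eq_empty (hB : B.IsBouquet) (hE : B.edges.Nonempty) :
    B.isolatedVerts = ∅ := by
  obtain ⟨e, he⟩ := hE
  exact Set.eq_empty_of_forall_notMem fun v hv =>
    hv.2 (e, false) he (Finset.card_le_one.1 hB.le _ (B.inc_mem _ he) _ hv.1)

theorem card_face_of_edges_eq_empty (hE : B.edges = ∅) : Nat.card B.Face = B.verts.card := by
  have : Subsingleton B.boundaryColourings := ⟨fun c d => Subtype.ext <| funext fun p => by
    rw [c.2.eq_zero p (by simp [hE]), d.2.eq_zero p (by simp [hE])]⟩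
  have hiso : B.isolatedVerts = B.verts := by
    ext v
    simp [isolatedVerts, hE]
  rw [card_face, Module.finrank_zero_of_subsingleton, hiso, Set.ncard_coe_finset, zero_add]

theorem IsBouquet.card_face_add_rank (hB : B.IsBouquet) :
    Nat.card B.Face + B.signedIntersectionGraph.adj.rank = B.edges.card + 1 := by
  obtain hE | hE := B.edges.eq_empty_or_nonempty
  · have hcard : B.edges.card = 0 := Finset.card_eq_zero.2 hE
    have hrank := B.signedIntersectionGraph.adj.rank_le_card_width
    rw [Fintype.card_coe] at hrank
    rw [card_face_of_edges_eq_empty hE, hB]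
    omega
  · have hsideDiff := B.sideDiffMap.finrank_range_add_finrank_ker
    have hadj := B.signedIntersectionGraph.adj.mulVecLin.finrank_range_add_finrank_ker
    rw [hB.range_sideDiffMap, hB.finrank_ker_sideDiffMap hE] at hsideDiff
    rw [Module.finrank_fintype_fun_eq_card, Fintype.card_coe] at hadj
    rw [card_face, hB.isolatedVerts_eq_empty hE, Set.ncard_empty, Matrix.rank]
    omega

theorem IsBouquet.eulerGenus (hB : B.IsBouquet) (hconn : B.Connected) :
    B.eulerGenus = B.signedIntersectionGraph.adj.rank := by
  have hface := hB.card_face_add_rank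
  rw [hconn.eulerGenus, eulerChar, hB]
  omega

end BouquetColouring

end RibbonGraph

theorem theorem1 {V E : Type*} [DecidableEq V] [DecidableEq E] (G : RibbonGraph V E)
    (hG : G.Connected) (T : Finset E) (hT : G.IsSpanningTree T)
    (l : List E) (hl : l.Nodup) (hlT : l.toFinset = T) :
    (G.aux l).IsBouquet ∧ (G.aux l).edges = G.edges \ T ∧
      G.eulerGenus = ((G.aux l).signedIntersectionGraph.adj.rank : ℤ) := by
  subst hlT
  have hmin := hT.minimallyConnects
  have haux := hmin.aux hl
  have hbouquet : (G.aux l).IsBouquet := haux.card_verts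
  refine ⟨hbouquet, hmin.edges_aux hl, ?_⟩
  rw [← hmin.eulerGenus_aux hl, hbouquet.eulerGenus haux.connected_graph]
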